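/- **Theorem.** Fix $d\ge 1$ and let $\rho_0\ne\rho_1$ be two quantum states on $\mathbb{C}^d$ (positive semidefinite $d\times d$ matrices of unit trace) with full support, i.e. with strictly positive eigenvalues. A POVM with finite outcome set $\mathcal X$ is a family $m=(m(x))_{x\in\mathcal X}$ of positive semidefinite matrices summing to the identity; measuring $\rho$ with $m$ gives $x$ with probability $P_{\rho,m}(x)=\mathrm{Tr}[\rho\, m(x)]$. The measured relative entropy is $D_{\mathcal M}(\rho\|\sigma)=\sup_m D(P_{\rho,m}\|P_{\sigma,m})$, where $D$ is the classical relative entropy and the supremum runs over all rank-one projector-valued measures $m$ with $d$ outcomes. A sequential quantum hypothesis test $\mathcal S$ consists of a finite set $\mathcal X$, of conditional probability measures $\mu_k(\mathrm dm_k\mid x_1^{k-1},m_1^{k-1})$ ($k\ge1$) on the POVMs with outcome set $\mathcal X$, and of measurable decision functions $d_k(x_1^k,m_1^k)\in\{0,1,*\}$. In round $k$ the POVM $M_k$ is drawn from $\mu_k$ given the past and applied to a fresh copy of the unknown state $\rho$, giving the outcome $X_k$; if $d_k=i\in\{0,1\}$ the test stops and declares $\rho_i$, and if $d_k=*$ it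 continues. Let $T$ be the first $k$ with $d_k\ne *$ ($T=\infty$ if there is none), and let $\mathbb P_{\mathcal S,\rho}$ be the resulting law of $(M_k,X_k)_{k\ge1}$. A pair $(R_0,R_1)\in[0,\infty)^2$ is achievable under the expectation constraint if there is a sequence of tests $(\mathcal S_n)_{n}$, each with its own finite outcome set and with number of samples $T_n$, whose error probabilities $\alpha_n=\mathbb P_{\mathcal S_n,\rho_0}(d_{T_n}=1)$ and $\beta_n=\mathbb P_{\mathcal S_n,\rho_1}(d_{T_n}=0)$ tend to $0$ and satisfy $$\liminf_{n\to\infty}\frac1n\log\frac1{\alpha_n}\ge R_0,\qquad \liminf_{n\to\infty}\frac1n\log\frac1{\beta_n}\ge R_1,\qquad \limsup_{n\to\infty}\Big(\max_{i\in\{0,1\}}\mathbb E_{\mathcal S_n,\rho_i}[T_n]-n\Big)\le 0 .$$ Let $\mathcal A_{\mathrm E}(\rho_0,\rho_1)$ be the closure of the set of achievable pairs. Then $$\mathcal A_{\mathrm E}(\rho_0,\rho_1)=\big\{(R_0,R_1)\in[0,\infty)^2:\ R_0\le D_{\mathcal M}(\rho_1\|\rho_0),\ R_1\le D_{\mathcal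 M}(\rho_0\|\rho_1)\big\}.$$ -/

import Mathlib

open MeasureTheory ProbabilityTheory Filter Topology
open scoped ENNReal ComplexOrder

namespace SeqQHT

/-- A quantum state on `ℂ^d`: a positive semidefinite matrix of unit trace. -/
structure QState (d : ℕ) where
  mat : Matrix (Fin d) (Fin d) ℂ
  posSemidef : mat.PosSemidef
  trace_eq_one : mat.trace = 1

/-- A state has full support if all its eigenvalues are strictly positive. -/
def QState.FullSupport {d : ℕ} (ρ : QState d) : Prop := ρ.mat.PosDef

/-- A POVM on `ℂ^d` with outcome set `{0, …, r - 1}`. -/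
structure POVM (d r : ℕ) where
  effect : Fin r → Matrix (Fin d) (Fin d) ℂ
  posSemidef : ∀ x, (effect x).PosSemidef
  sum_eq_one : ∑ x, effect x = 1

/-- The σ-algebra on POVMs generated by the matrix entries. It is the Borel σ-algebra of the
Euclidean topology. -/
noncomputable instance (d r : ℕ) : MeasurableSpace (POVM d r) :=
  MeasurableSpace.comap (fun m x i j => m.effect x i j)
    (inferInstance : MeasurableSpace (Fin r → Fin d → Fin d → ℂ))

/-- A rank-1 PVM consisting of `d` projectors. -/
def POVM.IsRankOnePVM {d : ℕ} (m : POVM d d) : Prop :=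
  ∀ x, m.effect x * m.effect x = m.effect x ∧ (m.effect x).rank = 1

/-- Born's rule: the probability `Tr[ρ m(x)]` of the outcome `x`. -/
noncomputable def bornProb {d r : ℕ} (ρ : QState d) (m : POVM d r) (x : Fin r) : ℝ :=
  (ρ.mat * m.effect x).trace.re

open scoped MatrixOrder Matrix.Norms.L2Operator in
theorem bornProb_nonneg {d r : ℕ} (ρ : QState d) (m : POVM d r) (x : Fin r) :
    0 ≤ bornProb ρ m x := by
  obtain ⟨B, hB⟩ := CStarAlgebra.nonneg_iff_eq_star_mul_self.mp (m.posSemidef x).nonneg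
  have h : 0 ≤ (B * ρ.mat * B.conjTranspose).trace :=
    (ρ.posSemidef.mul_mul_conjTranspose_same B).trace_nonneg
  have h2 : (ρ.mat * m.effect x).trace = (B * ρ.mat * B.conjTranspose).trace := by
    rw [hB, Matrix.star_eq_conjTranspose, ← Matrix.mul_assoc, Matrix.trace_mul_comm, ← Matrix.mul_assoc]
  unfold bornProb
  rw [h2]
  exact (Complex.le_def.mp h).1

theorem bornProb_sum {d r : ℕ} (ρ : QState d) (m : POVM d r) :
    ∑ x, bornProb ρ m x = 1 := by
  unfold bornProb
  rw [← Complex.re_sum, ← Matrix.trace_sum, ← Matrix.mul_sum, m.sum_eq_one, Matrix.mul_one,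
    ρ.trace_eq_one, Complex.one_re]

theorem measurable_bornProb {d r : ℕ} (ρ : QState d) (x : Fin r) :
    Measurable (fun m : POVM d r => bornProb ρ m x) := by
  have h : ∀ i j, Measurable (fun m : POVM d r => m.effect x i j) := fun i j =>
    Measurable.comp (g := fun f : Fin r → Fin d → Fin d → ℂ => f x i j) (by fun_prop)
      (comap_measurable _)
  unfold bornProb Matrix.trace
  simp only [Matrix.diag_apply, Matrix.mul_apply]
  fun_prop

/-- The outcome distribution `P_{ρ,m}` on `{0, …, r - 1}`, as a kernel in the POVM `m`. -/
noncomputable def bornKernel {d r : ℕ} (ρ : QState d) : Kernel (POVM d r) (Fin r) where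
  toFun m := ∑ x, ENNReal.ofReal (bornProb ρ m x) • Measure.dirac x
  measurable' := by
    refine Measure.measurable_of_measurable_coe _ fun s hs => ?_
    simp only [Measure.coe_finsetSum, Finset.sum_apply, Measure.smul_apply, smul_eq_mul]
    exact Finset.measurable_sum _ fun x _ =>
      ((measurable_bornProb ρ x).ennreal_ofReal).mul_const _

instance {d r : ℕ} (ρ : QState d) : IsMarkovKernel (bornKernel (r := r) ρ) where
  isProbabilityMeasure m := ⟨by
    change (∑ x, ENNReal.ofReal (bornProb ρ m x) • Measure.dirac x : Measure (Fin r)) Set.univ = 1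
    simp only [Measure.coe_finsetSum, Finset.sum_apply, Measure.smul_apply, smul_eq_mul,
      measure_univ, mul_one]
    rw [← ENNReal.ofReal_sum_of_nonneg fun x _ => bornProb_nonneg ρ m x, bornProb_sum,
      ENNReal.ofReal_one]⟩

/-- The measured relative entropy `D_M(ρ‖σ)`: the supremum of the relative entropies
`D(P_{ρ,m} ‖ P_{σ,m})` over all rank-1 PVMs `m` comprised of `d` projectors. -/
noncomputable def measuredRelEntropy {d : ℕ} (ρ σ : QState d) : ℝ≥0∞ :=
  ⨆ (m : POVM d d) (_ : m.IsRankOnePVM),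
    InformationTheory.klDiv (bornKernel ρ m) (bornKernel σ m)

/-- Measurements and outcomes `(m_j, x_j)` in the rounds `0, …, k`. -/
abbrev History (d r k : ℕ) : Type := (_ : Finset.Iic k) → POVM d r × Fin r

/-- Infinite sequences of measurements and outcomes. -/
abbrev Path (d r : ℕ) : Type := ℕ → POVM d r × Fin r

/-- A sequential quantum hypothesis test with outcome set `{0, …, r - 1}`. Rounds are numbered
from `0`, so that `k + 1` samples have been used after round `k`. -/
structure SQHT (d r : ℕ) where
  /-- the law of the POVM used in round `0` -/
  init : Measure (POVM d r)
  /-- the conditional law of the POVM used in round `k + 1`, given the rounds `0, …, k` -/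
  next : (k : ℕ) → Kernel (History d r k) (POVM d r)
  /-- the decision after round `k`: continue (`none`) or stop and declare `ρ₀` (`some 0`) or
  `ρ₁` (`some 1`) -/
  decision : (k : ℕ) → History d r k → Option (Fin 2)
  isProbabilityMeasure_init : IsProbabilityMeasure init
  isMarkovKernel_next : ∀ k, IsMarkovKernel (next k)
  measurableSet_decision : ∀ k a, MeasurableSet (decision k ⁻¹' {a})

attribute [instance] SQHT.isProbabilityMeasure_init SQHT.isMarkovKernel_next

namespace SQHT

variable {d r : ℕ}

/-- The conditional law of the POVM and the outcome of round `k + 1`, given the rounds `0, …, k`,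
when the underlying state is `ρ`. -/
noncomputable def step (S : SQHT d r) (ρ : QState d) (k : ℕ) :
    Kernel (History d r k) (POVM d r × Fin r) :=
  S.next k ⊗ₖ Kernel.prodMkLeft (History d r k) (bornKernel ρ)

instance (S : SQHT d r) (ρ : QState d) (k : ℕ) : IsMarkovKernel (S.step ρ k) := by
  unfold step; infer_instance

/-- The law `P_{S,ρ}` on the infinite sequences of measurements and outcomes when the underlying
state is `ρ`. -/
noncomputable def law (S : SQHT d r) (ρ : QState d) : Measure (Path d r) :=
  Kernel.trajMeasure (X := fun _ => POVM d r × Fin r) (S.init ⊗ₘ bornKernel ρ) (S.step ρ)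

/-- The decision after round `k` along the path `ω`. -/
def decisionAt (S : SQHT d r) (k : ℕ) (ω : Path d r) : Option (Fin 2) :=
  S.decision k (fun i => ω i)

/-- The number `T` of samples used by the test; it is `⊤` if the test never stops. -/
noncomputable def stopTime (S : SQHT d r) (ω : Path d r) : ℕ∞ :=
  ⨅ (k : ℕ) (_ : S.decisionAt k ω ≠ none), ((k + 1 : ℕ) : ℕ∞)

/-- The event `d_T = a` that the test stops and declares `ρ_a`. -/
def declares (S : SQHT d r) (a : Fin 2) : Set (Path d r) :=
  {ω | ∃ k, (∀ j < k, S.decisionAt j ω = none) ∧ S.decisionAt k ω = some a}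

/-- The expected number of samples `E[T]` when the underlying state is `ρ`. -/
noncomputable def expectedTime (S : SQHT d r) (ρ : QState d) : ℝ≥0∞ :=
  ∫⁻ ω, (S.stopTime ω : ℝ≥0∞) ∂(S.law ρ)

end SQHT

/-- `(R₀, R₁)` is achievable under the expectation constraint: there is a sequence of tests, each
with its own finite outcome set, with vanishing error probabilities `α_n` and `β_n` that decay
with exponents at least `R₀` and `R₁`, and with
`limsup_n (max_i E_{n,i}[T_n] - n) ≤ 0`. -/
def IsAchievable {d : ℕ} (ρ₀ ρ₁ : QState d) (R : ℝ × ℝ) : Prop :=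
  0 ≤ R.1 ∧ 0 ≤ R.2 ∧
  ∃ (r : ℕ → ℕ) (S : (n : ℕ) → SQHT d (r n)),
    Tendsto (fun n => (S n).law ρ₀ ((S n).declares 1)) atTop (𝓝 0) ∧
    Tendsto (fun n => (S n).law ρ₁ ((S n).declares 0)) atTop (𝓝 0) ∧
    (R.1 : EReal) ≤ liminf (fun n : ℕ =>
      ((1 / n : ℝ) : EReal) * ENNReal.log ((S n).law ρ₀ ((S n).declares 1))⁻¹) atTop ∧
    (R.2 : EReal) ≤ liminf (fun n : ℕ =>
      ((1 / n : ℝ) : EReal) * ENNReal.log ((S n).law ρ₁ ((S n).declares 0))⁻¹) atTop ∧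
    limsup (fun n : ℕ =>
      ((max ((S n).expectedTime ρ₀) ((S n).expectedTime ρ₁) : ℝ≥0∞) : EReal) - (n : EReal))
      atTop ≤ 0

/-- The error exponent region `A_E(ρ₀, ρ₁)` under the expectation constraint. -/
def errorExponentRegion {d : ℕ} (ρ₀ ρ₁ : QState d) : Set (ℝ × ℝ) :=
  closure {R | IsAchievable ρ₀ ρ₁ R}

end SeqQHT

/-! Everything rests on the log-likelihood ratio `Λ` of the observed outcomes. When `ρ` is true, its
conditional mean increment is the relative entropy of the outcome laws of the chosen POVM. Full
support bounds the increments uniformly over all POVMs (`exists_abs_logRatio_le`).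

No POVM gains more than the best rank-one projective measurement
(`exists_isRankOnePVM_outcomeRelEntropy_le`). If `b x` are the likelihood ratios of `m`, one
measures in an eigenbasis of `A = ∑ b x • m x`. Completing a square gives Jensen's inequality for
the resolvents of `A`, integration over the shift turns it into an inequality for logarithms, and
Gibbs' inequality replaces the eigenvalues by the true likelihood ratios.

Converse: by Wald's identity the mean of the stopped `Λ` under `ρ` is at most `D * E[T]`, where `D`
is the measured relative entropy. A change of measure turns the integral of `exp (-Λ)` over the
event of a correct declaration into the error probability under `σ`. Hence `P(correct) * log
(1/error)` is at most `D * E[T]` up to a constant (`law_declares_mul_log_le`).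

Achievability: a sequential probability ratio test measures with a nearly optimal projective
measurement for whichever state `Λ` favours. Its thresholds control the errors by change of measure.
The drift is the desired one whenever `Λ` has the correct sign, and the expected number of rounds
with the wrong sign is bounded, since `E[exp (-Λ/2)]` decays geometrically (`expectedTime_le`). So
`E[T]` is threshold over drift plus a constant, and rates strictly below the entropies absorb the
constant. Both entropies are positive because the states differ, and the closure supplies the
boundary. -/

namespace SeqQHT

/-! ### Projective measurements in an eigenbasis -/

section Eigenbasis

open Matrix

variable {d : ℕ}

open scoped MatrixOrder Matrix.Norms.L2Operator in
theorem trace_mul_re_nonneg {A B : Matrix (Fin d) (Fin d) ℂ} (hA : A.PosSemidef)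
    (hB : B.PosSemidef) : 0 ≤ (A * B).trace.re := by
  obtain ⟨C, hC⟩ := CStarAlgebra.nonneg_iff_eq_star_mul_self.mp hB.nonneg
  have h : 0 ≤ (C * A * C.conjTranspose).trace := (hA.mul_mul_conjTranspose_same C).trace_nonneg
  have h2 : (A * B).trace = (C * A * C.conjTranspose).trace := by
    rw [hC, star_eq_conjTranspose, ← Matrix.mul_assoc, trace_mul_comm, ← Matrix.mul_assoc]
  rw [h2]
  exact (Complex.le_def.mp h).1

/-- The projector onto the `i`-th eigenvector of a Hermitian matrix. -/
noncomputable def eigenProj {A : Matrix (Fin d) (Fin d) ℂ} (hA : A.IsHermitian) (i : Fin d) :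
    Matrix (Fin d) (Fin d) ℂ :=
  (hA.eigenvectorUnitary : Matrix (Fin d) (Fin d) ℂ) * diagonal (Pi.single i 1) *
    star (hA.eigenvectorUnitary : Matrix (Fin d) (Fin d) ℂ)

variable {A : Matrix (Fin d) (Fin d) ℂ} (hA : A.IsHermitian)

theorem star_eigenvectorUnitary_mul_self :
    star (hA.eigenvectorUnitary : Matrix (Fin d) (Fin d) ℂ) *
      (hA.eigenvectorUnitary : Matrix (Fin d) (Fin d) ℂ) = 1 :=
  Unitary.coe_star_mul_self _

theorem eigenvectorUnitary_mul_star_self :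
    (hA.eigenvectorUnitary : Matrix (Fin d) (Fin d) ℂ) *
      star (hA.eigenvectorUnitary : Matrix (Fin d) (Fin d) ℂ) = 1 :=
  Unitary.coe_mul_star_self _

theorem eigenProj_posSemidef (i : Fin d) : (eigenProj hA i).PosSemidef := by
  unfold eigenProj
  rw [star_eq_conjTranspose]
  refine PosSemidef.mul_mul_conjTranspose_same (PosSemidef.diagonal ?_) _
  intro j
  by_cases h : j = i
  · subst h; simp
  · simp [h]

/-- This is the functional calculus of `A` by hand: `c = 1` gives completeness, `c = eigenvalues`
the spectral decomposition, and products become pointwise. -/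
theorem sum_smul_eigenProj (c : Fin d → ℂ) :
    ∑ i, c i • eigenProj hA i =
      (hA.eigenvectorUnitary : Matrix (Fin d) (Fin d) ℂ) * diagonal c *
        star (hA.eigenvectorUnitary : Matrix (Fin d) (Fin d) ℂ) := by
  have h : diagonal c = ∑ i, c i • (diagonal (Pi.single i 1) : Matrix (Fin d) (Fin d) ℂ) := by
    ext a b
    rw [Matrix.sum_apply]
    by_cases hab : a = b
    · subst hab
      simp [Pi.single_apply]
    · simp [hab]
  simp only [eigenProj, h, Finset.mul_sum, Finset.sum_mul, Matrix.mul_smul, Matrix.smul_mul]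

theorem sum_smul_eigenProj_mul (b c : Fin d → ℂ) :
    (∑ i, b i • eigenProj hA i) * (∑ i, c i • eigenProj hA i) =
      ∑ i, (b i * c i) • eigenProj hA i := by
  rw [sum_smul_eigenProj, sum_smul_eigenProj, sum_smul_eigenProj]
  have h := star_eigenvectorUnitary_mul_self hA
  set U := (hA.eigenvectorUnitary : Matrix (Fin d) (Fin d) ℂ)
  calc U * diagonal b * star U * (U * diagonal c * star U)
      = U * diagonal b * (star U * U) * diagonal c * star U := by simp only [Matrix.mul_assoc]
    _ = _ := by rw [h, Matrix.mul_one, Matrix.mul_assoc U, diagonal_mul_diagonal]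

theorem sum_eigenProj : ∑ i, eigenProj hA i = 1 := by
  have h := sum_smul_eigenProj hA 1
  simpa [eigenvectorUnitary_mul_star_self] using h

theorem sum_eigenvalues_smul_eigenProj :
    ∑ i, (hA.eigenvalues i : ℂ) • eigenProj hA i = A := by
  rw [sum_smul_eigenProj]
  conv_rhs => rw [hA.spectral_theorem, Unitary.conjStarAlgAut_apply]
  rfl

theorem eigenProj_mul_self (i : Fin d) : eigenProj hA i * eigenProj hA i = eigenProj hA i := by
  have h := sum_smul_eigenProj_mul hA (Pi.single i 1) (Pi.single i 1)
  simpa [Pi.single_apply, ite_and] using h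

theorem trace_eigenProj (i : Fin d) : (eigenProj hA i).trace = 1 := by
  unfold eigenProj
  rw [trace_mul_comm, ← Matrix.mul_assoc, star_eigenvectorUnitary_mul_self, Matrix.one_mul,
    trace_diagonal]
  simp

theorem rank_eigenProj (i : Fin d) : (eigenProj hA i).rank = 1 := by
  have h1 : IsUnit (hA.eigenvectorUnitary : Matrix (Fin d) (Fin d) ℂ).det :=
    (isUnit_iff_isUnit_det _).mp
      (IsUnit.of_mul_eq_one _ (eigenvectorUnitary_mul_star_self hA))
  have h2 : IsUnit (star (hA.eigenvectorUnitary : Matrix (Fin d) (Fin d) ℂ)).det :=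
    (isUnit_iff_isUnit_det _).mp
      (IsUnit.of_mul_eq_one _ (star_eigenvectorUnitary_mul_self hA))
  unfold eigenProj
  rw [rank_mul_eq_left_of_isUnit_det _ _ h2, rank_mul_eq_right_of_isUnit_det _ _ h1,
    rank_diagonal, Fintype.card_eq_one_iff]
  refine ⟨⟨i, by simp⟩, fun j => Subtype.ext ?_⟩
  by_contra hj
  exact j.2 (by simp [hj])

/-- The projective measurement in an eigenbasis of a Hermitian matrix. -/
noncomputable def eigenPVM : POVM d d where
  effect := eigenProj hA
  posSemidef := eigenProj_posSemidef hA
  sum_eq_one := sum_eigenProj hA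

theorem isRankOnePVM_eigenPVM : (eigenPVM hA).IsRankOnePVM :=
  fun i => ⟨eigenProj_mul_self hA i, rank_eigenProj hA i⟩

/-- For positive semidefinite `B` the weights are nonnegative and sum to its trace, so eigenvalue
bounds become bounds on outcome probabilities. -/
theorem trace_mul_re_eq_sum (B : Matrix (Fin d) (Fin d) ℂ) :
    (A * B).trace.re = ∑ i, hA.eigenvalues i * (eigenProj hA i * B).trace.re := by
  conv_lhs => rw [← sum_eigenvalues_smul_eigenProj hA]
  simp [Finset.sum_mul, trace_sum, Complex.re_sum]

theorem sum_trace_eigenProj_mul_re (B : Matrix (Fin d) (Fin d) ℂ) :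
    ∑ i, (eigenProj hA i * B).trace.re = B.trace.re := by
  rw [← Complex.re_sum, ← trace_sum, ← Finset.sum_mul, sum_eigenProj, Matrix.one_mul]

end Eigenbasis

/-! ### Outcome probabilities of states with full support -/

section Born

variable {d r : ℕ}

theorem QState.eigenvalues_le_one (ρ : QState d) (i : Fin d) :
    ρ.posSemidef.isHermitian.eigenvalues i ≤ 1 := by
  have h : ∑ j, ρ.posSemidef.isHermitian.eigenvalues j = 1 := by
    have := ρ.posSemidef.isHermitian.trace_eq_sum_eigenvalues
    rw [ρ.trace_eq_one] at this
    have h2 := congrArg Complex.re this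
    simpa [Complex.re_sum] using h2.symm
  rw [← h]
  exact Finset.single_le_sum (f := ρ.posSemidef.isHermitian.eigenvalues)
    (fun j _ => ρ.posSemidef.eigenvalues_nonneg j) (Finset.mem_univ i)

theorem bornProb_le_trace (ρ : QState d) (m : POVM d r) (x : Fin r) :
    bornProb ρ m x ≤ (m.effect x).trace.re := by
  unfold bornProb
  rw [trace_mul_re_eq_sum ρ.posSemidef.isHermitian,
    ← sum_trace_eigenProj_mul_re ρ.posSemidef.isHermitian]
  refine Finset.sum_le_sum fun i _ => ?_
  exact mul_le_of_le_one_left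
    (trace_mul_re_nonneg (eigenProj_posSemidef _ i) (m.posSemidef x)) (ρ.eigenvalues_le_one i)

/-- The smallest eigenvalue serves as `c`. It is fixed before the POVM and its number of outcomes,
and all later uniformity comes from this. -/
theorem QState.FullSupport.exists_le_bornProb {ρ : QState d} (h : ρ.FullSupport) :
    ∃ c : ℝ, 0 < c ∧ ∀ {r : ℕ} (m : POVM d r) (x : Fin r),
      c * (m.effect x).trace.re ≤ bornProb ρ m x := by
  have hpos : ∀ i, 0 < ρ.posSemidef.isHermitian.eigenvalues i := fun i =>
    Matrix.PosDef.eigenvalues_pos h i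
  obtain ⟨c, hc, hle⟩ : ∃ c : ℝ, 0 < c ∧ ∀ i, c ≤ ρ.posSemidef.isHermitian.eigenvalues i := by
    rcases isEmpty_or_nonempty (Fin d) with hd | hd
    · exact ⟨1, one_pos, fun i => hd.elim i⟩
    · obtain ⟨i, hi⟩ := Finite.exists_min ρ.posSemidef.isHermitian.eigenvalues
      exact ⟨_, hpos i, hi⟩
  refine ⟨c, hc, fun m x => ?_⟩
  unfold bornProb
  rw [trace_mul_re_eq_sum ρ.posSemidef.isHermitian,
    ← sum_trace_eigenProj_mul_re ρ.posSemidef.isHermitian, Finset.mul_sum]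
  exact Finset.sum_le_sum fun i _ => mul_le_mul_of_nonneg_right (hle i)
    (trace_mul_re_nonneg (eigenProj_posSemidef _ i) (m.posSemidef x))

theorem trace_effect_re_nonneg (m : POVM d r) (x : Fin r) : 0 ≤ (m.effect x).trace.re :=
  (Complex.le_def.mp (m.posSemidef x).trace_nonneg).1

theorem trace_effect_re_eq_zero_iff (m : POVM d r) (x : Fin r) :
    (m.effect x).trace.re = 0 ↔ m.effect x = 0 := by
  rw [← (m.posSemidef x).trace_eq_zero_iff]
  have := (Complex.le_def.mp (m.posSemidef x).trace_nonneg).2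
  exact ⟨fun h => Complex.ext h this.symm, fun h => by rw [h]; rfl⟩

theorem bornProb_of_effect_eq_zero (ρ : QState d) {m : POVM d r} {x : Fin r}
    (h : m.effect x = 0) : bornProb ρ m x = 0 := by
  simp [bornProb, h]

theorem QState.FullSupport.bornProb_pos {ρ : QState d} (h : ρ.FullSupport) {m : POVM d r}
    {x : Fin r} (hx : m.effect x ≠ 0) : 0 < bornProb ρ m x := by
  obtain ⟨c, hc, hle⟩ := h.exists_le_bornProb
  refine lt_of_lt_of_le (mul_pos hc ?_) (hle m x)
  exact lt_of_le_of_ne (trace_effect_re_nonneg m x)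
    fun h0 => hx ((trace_effect_re_eq_zero_iff m x).mp h0.symm)

theorem POVM.IsRankOnePVM.effect_ne_zero {m : POVM d d} (hm : m.IsRankOnePVM) (x : Fin d) :
    m.effect x ≠ 0 := by
  intro h
  have := (hm x).2
  simp [h] at this

/-- The log-likelihood ratio of the outcome `x` of the measurement `m`. -/
noncomputable def logRatio (ρ σ : QState d) (y : POVM d r × Fin r) : ℝ :=
  Real.log (bornProb ρ y.1 y.2 / bornProb σ y.1 y.2)

theorem logRatio_swap (ρ σ : QState d) (y : POVM d r × Fin r) :
    logRatio σ ρ y = -logRatio ρ σ y := by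
  unfold logRatio
  rw [← Real.log_inv, inv_div]

theorem measurable_logRatio (ρ σ : QState d) :
    Measurable (logRatio (r := r) ρ σ) := by
  have h : ∀ τ : QState d, Measurable fun y : POVM d r × Fin r => bornProb τ y.1 y.2 := fun τ =>
    measurable_from_prod_countable_left fun x => measurable_bornProb τ x
  exact Real.measurable_log.comp ((h ρ).div (h σ))

/-- One-round change of measure. By full support both probabilities vanish exactly where the effect
does, so the junk value of `logRatio` there has weight zero. -/
theorem bornProb_mul_exp_neg_logRatio {ρ σ : QState d} (hρ : ρ.FullSupport)
    (hσ : σ.FullSupport) (m : POVM d r) (x : Fin r) :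
    bornProb ρ m x * Real.exp (-logRatio ρ σ (m, x)) = bornProb σ m x := by
  by_cases hx : m.effect x = 0
  · simp [bornProb_of_effect_eq_zero _ hx]
  · have h1 := hρ.bornProb_pos hx
    have h2 := hσ.bornProb_pos hx
    unfold logRatio
    rw [Real.exp_neg, Real.exp_log (div_pos h1 h2)]
    field_simp

theorem exists_abs_logRatio_le {ρ σ : QState d} (hρ : ρ.FullSupport) (hσ : σ.FullSupport) :
    ∃ C : ℝ, 0 ≤ C ∧ ∀ {r : ℕ} (y : POVM d r × Fin r), |logRatio ρ σ y| ≤ C := by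
  -- One-sided bounds suffice, since exchanging the states flips the sign.
  have key : ∀ {ρ σ : QState d}, ρ.FullSupport → σ.FullSupport →
      ∃ C : ℝ, 0 ≤ C ∧ ∀ {r : ℕ} (y : POVM d r × Fin r), logRatio ρ σ y ≤ C := by
    intro ρ σ hρ hσ
    obtain ⟨c, hc, hle⟩ := hσ.exists_le_bornProb
    refine ⟨max 0 (Real.log (1 / c)), le_max_left _ _, fun {r} y => ?_⟩
    by_cases hx : y.1.effect y.2 = 0
    · simp [logRatio, bornProb_of_effect_eq_zero _ hx]
    · have h1 := hρ.bornProb_pos hx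
      have h2 := hσ.bornProb_pos hx
      refine le_trans (Real.log_le_log (div_pos h1 h2) ?_) (le_max_right _ _)
      rw [div_le_div_iff₀ h2 hc, one_mul, mul_comm]
      exact (mul_le_mul_of_nonneg_left (bornProb_le_trace ρ y.1 y.2) hc.le).trans (hle y.1 y.2)
  obtain ⟨C, hC, h⟩ := key hρ hσ
  obtain ⟨C', hC', h'⟩ := key hσ hρ
  refine ⟨max C C', le_max_of_le_left hC, fun {r} y => abs_le.mpr ⟨?_, (h y).trans (le_max_left _ _)⟩⟩
  have := (h' y).trans (le_max_right C C')
  rw [logRatio_swap] at this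
  linarith

/-- The relative entropy of the outcome distributions of the measurement `m`. -/
noncomputable def outcomeRelEntropy (ρ σ : QState d) (m : POVM d r) : ℝ :=
  ∑ x, bornProb ρ m x * logRatio ρ σ (m, x)

theorem outcomeRelEntropy_nonneg {ρ σ : QState d} (hρ : ρ.FullSupport) (hσ : σ.FullSupport)
    (m : POVM d r) : 0 ≤ outcomeRelEntropy ρ σ m := by
  have h : ∀ x, bornProb ρ m x - bornProb σ m x ≤ bornProb ρ m x * logRatio ρ σ (m, x) := by
    intro x
    have h1 := bornProb_mul_exp_neg_logRatio hρ hσ m x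
    have h2 := mul_le_mul_of_nonneg_left (Real.add_one_le_exp (-logRatio ρ σ (m, x)))
      (bornProb_nonneg ρ m x)
    linarith
  have := Finset.sum_le_sum fun x (_ : x ∈ Finset.univ) => h x
  rw [Finset.sum_sub_distrib, bornProb_sum, bornProb_sum, sub_self] at this
  exact this

/-- The Bhattacharyya coefficient of the outcome distributions of the measurement `m`. -/
noncomputable def fidelity (ρ σ : QState d) (m : POVM d r) : ℝ :=
  ∑ x, bornProb ρ m x * Real.exp (-(logRatio ρ σ (m, x) / 2))

theorem fidelity_nonneg (ρ σ : QState d) (m : POVM d r) : 0 ≤ fidelity ρ σ m :=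
  Finset.sum_nonneg fun x _ => mul_nonneg (bornProb_nonneg ρ m x) (Real.exp_nonneg _)

/-- `2 * (1 - fidelity)` is a squared Hellinger distance, so a coefficient of one forces the
likelihood ratio to be one wherever `ρ` has mass. -/
theorem fidelity_lt_one {ρ σ : QState d} (hρ : ρ.FullSupport) (hσ : σ.FullSupport)
    {m : POVM d r} (h : outcomeRelEntropy ρ σ m ≠ 0) : fidelity ρ σ m < 1 := by
  have hdef : ∑ x, bornProb ρ m x * (1 - Real.exp (-(logRatio ρ σ (m, x) / 2))) ^ 2 =
      2 * (1 - fidelity ρ σ m) := by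
    have h1 : ∀ x, bornProb ρ m x * (1 - Real.exp (-(logRatio ρ σ (m, x) / 2))) ^ 2 =
        bornProb ρ m x - 2 * (bornProb ρ m x * Real.exp (-(logRatio ρ σ (m, x) / 2))) +
          bornProb σ m x := by
      intro x
      rw [← bornProb_mul_exp_neg_logRatio hρ hσ m x,
        show -logRatio ρ σ (m, x) = -(logRatio ρ σ (m, x) / 2) + -(logRatio ρ σ (m, x) / 2) by ring,
        Real.exp_add]
      ring
    rw [Finset.sum_congr rfl fun x _ => h1 x, Finset.sum_add_distrib, Finset.sum_sub_distrib,
      bornProb_sum, bornProb_sum, ← Finset.mul_sum]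
    unfold fidelity
    ring
  have hnn : ∀ x, 0 ≤ bornProb ρ m x * (1 - Real.exp (-(logRatio ρ σ (m, x) / 2))) ^ 2 :=
    fun x => mul_nonneg (bornProb_nonneg ρ m x) (sq_nonneg _)
  by_contra hge
  have h0 : ∑ x, bornProb ρ m x * (1 - Real.exp (-(logRatio ρ σ (m, x) / 2))) ^ 2 = 0 :=
    le_antisymm (by rw [hdef]; linarith [not_lt.mp hge]) (Finset.sum_nonneg fun x _ => hnn x)
  rw [Finset.sum_eq_zero_iff_of_nonneg fun x _ => hnn x] at h0
  refine h (Finset.sum_eq_zero fun x hx => ?_)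
  rcases mul_eq_zero.mp (h0 x hx) with h1 | h1
  · rw [h1, zero_mul]
  · have h2 : Real.exp (-(logRatio ρ σ (m, x) / 2)) = 1 := by
      linarith [pow_eq_zero_iff (two_ne_zero) |>.mp h1]
    rw [Real.exp_eq_one_iff] at h2
    rw [show logRatio ρ σ (m, x) = 0 by linarith, mul_zero]

/-! ### Kullback–Leibler divergences as finite sums -/

theorem integral_bornKernel (ρ : QState d) (m : POVM d r) (f : Fin r → ℝ) :
    ∫ x, f x ∂(bornKernel ρ m) = ∑ x, bornProb ρ m x * f x := by
  change ∫ x, f x ∂(∑ x, ENNReal.ofReal (bornProb ρ m x) • Measure.dirac x : Measure (Fin r)) = _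
  rw [integral_finsetSum_measure fun x _ => Integrable.of_finite.smul_measure ENNReal.ofReal_ne_top]
  refine Finset.sum_congr rfl fun x _ => ?_
  rw [integral_smul_measure, integral_dirac, ENNReal.toReal_ofReal (bornProb_nonneg ρ m x),
    smul_eq_mul]

theorem lintegral_bornKernel (ρ : QState d) (m : POVM d r) (f : Fin r → ℝ≥0∞) :
    ∫⁻ x, f x ∂(bornKernel ρ m) = ∑ x, ENNReal.ofReal (bornProb ρ m x) * f x := by
  change ∫⁻ x, f x ∂(∑ x, ENNReal.ofReal (bornProb ρ m x) • Measure.dirac x : Measure (Fin r)) = _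
  rw [lintegral_finsetSum_measure]
  refine Finset.sum_congr rfl fun x _ => ?_
  rw [lintegral_smul_measure, lintegral_dirac, smul_eq_mul]

/-- Rank one makes every effect nonzero, so `σ` charges every outcome. -/
theorem bornKernel_eq_withDensity (ρ : QState d) {σ : QState d} (hσ : σ.FullSupport)
    {m : POVM d d} (hm : m.IsRankOnePVM) :
    bornKernel ρ m = (bornKernel σ m).withDensity
      (fun x => ENNReal.ofReal (bornProb ρ m x / bornProb σ m x)) := by
  ext s hs
  rw [withDensity_apply _ hs, ← lintegral_indicator hs, ← lintegral_indicator_one hs,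
    lintegral_bornKernel, lintegral_bornKernel]
  refine Finset.sum_congr rfl fun x _ => ?_
  have h2 := hσ.bornProb_pos (hm.effect_ne_zero x)
  by_cases hx : x ∈ s
  · simp only [hx, Set.indicator_of_mem, Pi.one_apply, mul_one]
    rw [← ENNReal.ofReal_mul h2.le, mul_div_cancel₀ _ h2.ne']
  · simp [hx]

theorem klDiv_bornKernel (ρ : QState d) {σ : QState d} (hσ : σ.FullSupport)
    {m : POVM d d} (hm : m.IsRankOnePVM) :
    InformationTheory.klDiv (bornKernel ρ m) (bornKernel σ m) =
      ENNReal.ofReal (outcomeRelEntropy ρ σ m) := by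
  have hd := bornKernel_eq_withDensity ρ hσ hm
  have hac : bornKernel ρ m ≪ bornKernel σ m := by
    rw [hd]; exact withDensity_absolutelyContinuous _ _
  have hrn : (bornKernel ρ m).rnDeriv (bornKernel σ m) =ᵐ[bornKernel σ m]
      fun x => ENNReal.ofReal (bornProb ρ m x / bornProb σ m x) := by
    conv_lhs => rw [hd]
    exact Measure.rnDeriv_withDensity _ (measurable_of_countable _)
  rw [InformationTheory.klDiv_of_ac_of_integrable hac Integrable.of_finite]
  -- The mass correction in `klDiv` cancels between probability measures.
  simp only [probReal_univ, add_sub_cancel_right]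
  congr 1
  rw [outcomeRelEntropy, ← integral_bornKernel ρ m fun x => logRatio ρ σ (m, x)]
  refine integral_congr_ae (hac.ae_le ?_)
  filter_upwards [hrn] with x hx
  rw [llr, hx, ENNReal.toReal_ofReal (div_nonneg (bornProb_nonneg _ _ _) (bornProb_nonneg _ _ _))]
  rfl

theorem measuredRelEntropy_eq_iSup (ρ : QState d) {σ : QState d} (hσ : σ.FullSupport) :
    measuredRelEntropy ρ σ =
      ⨆ (m : POVM d d) (_ : m.IsRankOnePVM), ENNReal.ofReal (outcomeRelEntropy ρ σ m) := by
  unfold measuredRelEntropy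
  exact iSup_congr fun m => iSup_congr fun hm => klDiv_bornKernel ρ hσ hm

end Born

end SeqQHT

namespace SeqQHT

/-! ### Rank-one projective measurements are optimal -/

section Optimality

variable {d r : ℕ}

theorem tendsto_log_add_sub_log (a : ℝ) :
    Tendsto (fun s : ℝ => Real.log (a + s) - Real.log s) atTop (𝓝 0) := by
  have h1 : Tendsto (fun s : ℝ => a / s + 1) atTop (𝓝 1) := by
    simpa using (tendsto_const_nhds (x := a)).div_atTop tendsto_id |>.add_const 1
  have h2 := (Real.continuousAt_log one_ne_zero).tendsto.comp h1
  rw [Real.log_one] at h2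
  refine h2.congr' ?_
  filter_upwards [eventually_gt_atTop 0, eventually_gt_atTop (-a)] with s hs hs'
  have h3 : 0 < a + s := by linarith
  rw [Function.comp_apply, ← Real.log_div h3.ne' hs.ne', add_div, div_self hs.ne']

/-- If two positive measures on `(0, ∞)` of the same mass have ordered Stieltjes transforms, then
their logarithmic moments are ordered. -/
theorem sum_mul_log_le_of_resolvent_le {ι κ : Type*} [Fintype ι] [Fintype κ] {p a : ι → ℝ}
    {P b : κ → ℝ} (ha : ∀ i, 0 < a i) (hb : ∀ x, 0 < b x) (hmass : ∑ i, p i = ∑ x, P x)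
    (hres : ∀ s, 0 ≤ s → ∑ i, p i / (a i + s) ≤ ∑ x, P x / (b x + s)) :
    ∑ x, P x * Real.log (b x) ≤ ∑ i, p i * Real.log (a i) := by
  -- `F` replaces the integral representation of the logarithm: its derivative is the difference of
  -- the resolvent sums, so it decreases to its limit `0`, and `F 0 ≥ 0` is the claim.
  set F : ℝ → ℝ := fun s => ∑ i, p i * Real.log (a i + s) - ∑ x, P x * Real.log (b x + s) with hF
  have hder : ∀ s, 0 ≤ s →
      HasDerivAt F (∑ i, p i / (a i + s) - ∑ x, P x / (b x + s)) s := by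
    intro s hs
    refine HasDerivAt.sub (HasDerivAt.fun_sum fun i _ => ?_) (HasDerivAt.fun_sum fun x _ => ?_)
    · have h : HasDerivAt (fun s => Real.log (a i + s)) (1 / (a i + s)) s :=
        ((hasDerivAt_id s).const_add (a i)).log (by have := ha i; simp; linarith)
      simpa [div_eq_mul_inv] using h.const_mul (p i)
    · have h : HasDerivAt (fun s => Real.log (b x + s)) (1 / (b x + s)) s :=
        ((hasDerivAt_id s).const_add (b x)).log (by have := hb x; simp; linarith)
      simpa [div_eq_mul_inv] using h.const_mul (P x)
  have hanti : AntitoneOn F (Set.Ici 0) := by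
    refine antitoneOn_of_deriv_nonpos (convex_Ici 0)
      (fun s hs => (hder s hs).continuousAt.continuousWithinAt) (fun s hs => ?_) fun s hs => ?_
    · rw [interior_Ici] at hs
      exact (hder s (le_of_lt hs)).differentiableAt.differentiableWithinAt
    · rw [interior_Ici] at hs
      rw [(hder s (le_of_lt hs)).deriv]
      linarith [hres s (le_of_lt hs)]
  have hlim : Tendsto F atTop (𝓝 0) := by
    -- Equality of the masses allows `log s` to be subtracted in every term.
    have h : F = fun s => ∑ i, p i * (Real.log (a i + s) - Real.log s) -
        ∑ x, P x * (Real.log (b x + s) - Real.log s) := by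
      funext s
      simp only [hF, mul_sub, Finset.sum_sub_distrib, ← Finset.sum_mul, hmass]
      ring
    rw [h]
    have h1 : Tendsto (fun s => ∑ i, p i * (Real.log (a i + s) - Real.log s)) atTop
        (𝓝 (∑ i, p i * 0)) :=
      tendsto_finsetSum _ fun i _ => (tendsto_log_add_sub_log (a i)).const_mul (p i)
    have h2 : Tendsto (fun s => ∑ x, P x * (Real.log (b x + s) - Real.log s)) atTop
        (𝓝 (∑ x, P x * 0)) :=
      tendsto_finsetSum _ fun x _ => (tendsto_log_add_sub_log (b x)).const_mul (P x)
    simpa using h1.sub h2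
  have h0 : 0 ≤ F 0 := by
    refine le_of_tendsto hlim ?_
    filter_upwards [eventually_ge_atTop 0] with s hs
    exact hanti Set.self_mem_Ici hs hs
  simp only [hF, add_zero] at h0
  linarith

open Matrix in
/-- The Jensen inequality for the resolvent, in the state `ρ`. -/
theorem sum_bornProb_div_le (ρ : QState d) (m : POVM d r) {b : Fin r → ℝ} (hb : ∀ x, 0 < b x)
    (hA : (∑ x, (b x : ℂ) • m.effect x).IsHermitian) (ha : ∀ i, 0 < hA.eigenvalues i)
    {s : ℝ} (hs : 0 ≤ s) :
    ∑ i, bornProb ρ (eigenPVM hA) i / (hA.eigenvalues i + s) ≤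
      ∑ x, bornProb ρ m x / (b x + s) := by
  set a := hA.eigenvalues with ha_def
  -- The resolvent `(A + s)⁻¹`, where `A = ∑ b x • m x`.
  set R : Matrix (Fin d) (Fin d) ℂ := ∑ i, ((1 / (a i + s) : ℝ) : ℂ) • eigenProj hA i with hR
  have hRherm : Rᴴ = R := by
    rw [hR, conjTranspose_sum]
    refine Finset.sum_congr rfl fun i _ => ?_
    rw [conjTranspose_smul, (eigenProj_posSemidef hA i).isHermitian.eq]
    congr 1
    simp
  have hRAR : R * (∑ x, ((b x + s : ℝ) : ℂ) • m.effect x) * R = R := by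
    have h1 : ∑ x, ((b x + s : ℝ) : ℂ) • m.effect x =
        ∑ i, ((a i + s : ℝ) : ℂ) • eigenProj hA i := by
      simp only [Complex.ofReal_add, add_smul, Finset.sum_add_distrib]
      rw [← Finset.smul_sum, ← Finset.smul_sum, m.sum_eq_one, sum_eigenProj,
        ha_def, sum_eigenvalues_smul_eigenProj hA]
    rw [h1, hR, sum_smul_eigenProj_mul, sum_smul_eigenProj_mul]
    refine Finset.sum_congr rfl fun i _ => ?_
    have h2 : a i + s ≠ 0 := by have := ha i; linarith
    rw [← Complex.ofReal_mul, ← Complex.ofReal_mul, one_div, inv_mul_cancel₀ h2, one_mul]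
  -- Completing the square: with `c = b x + s`, the positive terms `c (c⁻¹ - R) m(x) (c⁻¹ - R)` sum
  -- to `∑ c⁻¹ m(x) - R`, because `R (A + s) R = R`. The effects need neither commute nor be
  -- projectors.
  have hterm : ∀ x, 0 ≤ (ρ.mat * (((b x + s : ℝ) : ℂ) •
      ((((1 / (b x + s) : ℝ) : ℂ) • 1 - R) * m.effect x *
        (((1 / (b x + s) : ℝ) : ℂ) • 1 - R)))).trace.re := by
    intro x
    have hc : 0 < b x + s := by have := hb x; linarith
    refine trace_mul_re_nonneg ρ.posSemidef (PosSemidef.smul ?_ (by exact_mod_cast hc.le))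
    have h : (((1 / (b x + s) : ℝ) : ℂ) • (1 : Matrix (Fin d) (Fin d) ℂ) - R)ᴴ =
        ((1 / (b x + s) : ℝ) : ℂ) • 1 - R := by
      rw [conjTranspose_sub, hRherm, conjTranspose_smul, conjTranspose_one]
      simp
    have h2 := (m.posSemidef x).conjTranspose_mul_mul_same
      (((1 / (b x + s) : ℝ) : ℂ) • (1 : Matrix (Fin d) (Fin d) ℂ) - R)
    rwa [h] at h2
  have hexp : ∀ x, ((b x + s : ℝ) : ℂ) • ((((1 / (b x + s) : ℝ) : ℂ) • 1 - R) * m.effect x *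
        (((1 / (b x + s) : ℝ) : ℂ) • 1 - R)) =
      ((1 / (b x + s) : ℝ) : ℂ) • m.effect x - m.effect x * R - R * m.effect x +
        R * (((b x + s : ℝ) : ℂ) • m.effect x) * R := by
    intro x
    have hc : ((b x + s : ℝ) : ℂ) ≠ 0 := by
      have := hb x
      exact_mod_cast (by linarith : b x + s ≠ 0)
    simp only [sub_mul, mul_sub, smul_mul_assoc, mul_smul_comm, one_mul, mul_one, smul_sub,
      smul_smul, Complex.ofReal_div, Complex.ofReal_one]
    rw [mul_one_div_cancel hc, mul_one_div, mul_div_cancel₀ _ hc, one_smul, one_smul]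
    abel
  have hsum : ∑ x, ((b x + s : ℝ) : ℂ) • ((((1 / (b x + s) : ℝ) : ℂ) • 1 - R) * m.effect x *
        (((1 / (b x + s) : ℝ) : ℂ) • 1 - R)) =
      ∑ x, ((1 / (b x + s) : ℝ) : ℂ) • m.effect x - R := by
    rw [Finset.sum_congr rfl fun x _ => hexp x, Finset.sum_add_distrib, Finset.sum_sub_distrib,
      Finset.sum_sub_distrib, ← Finset.sum_mul, ← Finset.mul_sum, m.sum_eq_one, ← Finset.sum_mul,
      ← Finset.mul_sum, hRAR]
    simp
  have hmain := Finset.sum_nonneg fun x (_ : x ∈ Finset.univ) => hterm x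
  rw [← Complex.re_sum, ← trace_sum, ← Finset.mul_sum, hsum, mul_sub, trace_sub, Complex.sub_re,
    hR, Finset.mul_sum, Finset.mul_sum, trace_sum, trace_sum, Complex.re_sum, Complex.re_sum] at hmain
  simp only [mul_smul_comm, trace_smul, smul_eq_mul, Complex.re_ofReal_mul] at hmain
  refine (sub_nonneg.mp hmain).trans' (le_of_eq ?_) |>.trans (le_of_eq ?_)
  · exact Finset.sum_congr rfl fun i _ => (one_div_mul_eq_div _ _).symm
  · exact Finset.sum_congr rfl fun x _ => one_div_mul_eq_div _ _

/-- The relative entropy of the outcome distributions of a POVM is at most that of some rank-one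
projective measurement. -/
theorem exists_isRankOnePVM_outcomeRelEntropy_le {ρ σ : QState d} (hρ : ρ.FullSupport)
    (hσ : σ.FullSupport) (m : POVM d r) :
    ∃ e : POVM d d, e.IsRankOnePVM ∧ outcomeRelEntropy ρ σ m ≤ outcomeRelEntropy ρ σ e := by
  classical
  -- The value `1` on a vanishing effect keeps `b` positive and carries no weight.
  set b : Fin r → ℝ := fun x =>
    if m.effect x = 0 then 1 else bornProb ρ m x / bornProb σ m x with hb_def
  have hb : ∀ x, 0 < b x := by
    intro x
    by_cases hx : m.effect x = 0
    · simp [hb_def, hx]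
    · simpa [hb_def, hx] using div_pos (hρ.bornProb_pos hx) (hσ.bornProb_pos hx)
  have hpsd : ∀ x, ((b x : ℂ) • m.effect x).PosSemidef := fun x =>
    (m.posSemidef x).smul (by exact_mod_cast (hb x).le)
  have hA : (∑ x, (b x : ℂ) • m.effect x).IsHermitian := by
    rw [Matrix.IsHermitian, Matrix.conjTranspose_sum]
    exact Finset.sum_congr rfl fun x _ => (hpsd x).isHermitian.eq
  have hev : ∀ τ : QState d, ∑ i, bornProb τ (eigenPVM hA) i * hA.eigenvalues i =
      ∑ x, b x * bornProb τ m x := by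
    intro τ
    have h1 : (τ.mat * ∑ i, (hA.eigenvalues i : ℂ) • eigenProj hA i).trace.re =
        (τ.mat * ∑ x, (b x : ℂ) • m.effect x).trace.re := by
      rw [sum_eigenvalues_smul_eigenProj hA]
    simpa [Finset.mul_sum, Matrix.trace_sum, Complex.re_sum, bornProb, eigenPVM, mul_comm] using h1
  have ha : ∀ i, 0 < hA.eigenvalues i := by
    have hpd : (∑ x, (b x : ℂ) • m.effect x).PosDef := by
      rcases isEmpty_or_nonempty (Fin r) with hr | hr
      · have h1 := m.sum_eq_one
        have h2 := bornProb_sum ρ m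
        simp at h2
      -- The effects sum to the identity, so the operator dominates `b x₀ • 1`.
      · obtain ⟨x₀, hx₀⟩ := Finite.exists_min b
        have h1 : (∑ x, ((b x - b x₀ : ℝ) : ℂ) • m.effect x).PosSemidef :=
          Matrix.posSemidef_sum _ fun x _ =>
            (m.posSemidef x).smul (by exact_mod_cast sub_nonneg.mpr (hx₀ x))
        have h2 : ((b x₀ : ℂ) • (1 : Matrix (Fin d) (Fin d) ℂ)).PosDef :=
          Matrix.PosDef.one.smul (by exact_mod_cast hb x₀)
        have h3 := Matrix.PosDef.posSemidef_add h1 h2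
        rw [← m.sum_eq_one, Finset.smul_sum, ← Finset.sum_add_distrib] at h3
        convert h3 using 2 with x
        rw [← add_smul, Complex.ofReal_sub, sub_add_cancel]
    exact fun i => Matrix.PosDef.eigenvalues_pos hpd i
  refine ⟨eigenPVM hA, isRankOnePVM_eigenPVM hA, ?_⟩
  have hlog : ∑ x, bornProb ρ m x * Real.log (b x) ≤
      ∑ i, bornProb ρ (eigenPVM hA) i * Real.log (hA.eigenvalues i) :=
    sum_mul_log_le_of_resolvent_le ha hb (by rw [bornProb_sum, bornProb_sum])
      fun s hs => sum_bornProb_div_le ρ m hb hA ha hs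
  have hleft : outcomeRelEntropy ρ σ m = ∑ x, bornProb ρ m x * Real.log (b x) := by
    refine Finset.sum_congr rfl fun x _ => ?_
    by_cases hx : m.effect x = 0
    · simp [bornProb_of_effect_eq_zero _ hx]
    · simp [hb_def, hx, logRatio]
  -- Weighting the `σ`-probabilities by the eigenvalues gives a probability vector again, so the
  -- error terms in `hgibbs` cancel on summation.
  have hnorm : ∑ i, bornProb σ (eigenPVM hA) i * hA.eigenvalues i = 1 := by
    rw [hev, ← bornProb_sum ρ m]
    refine Finset.sum_congr rfl fun x _ => ?_
    by_cases hx : m.effect x = 0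
    · simp [bornProb_of_effect_eq_zero _ hx]
    · simp only [hb_def, hx, if_false]
      exact div_mul_cancel₀ _ (hσ.bornProb_pos hx).ne'
  have hgibbs : ∀ i, bornProb ρ (eigenPVM hA) i * Real.log (hA.eigenvalues i) ≤
      bornProb ρ (eigenPVM hA) i * logRatio ρ σ (eigenPVM hA, i) +
        (bornProb σ (eigenPVM hA) i * hA.eigenvalues i - bornProb ρ (eigenPVM hA) i) := by
    intro i
    have h0 := (isRankOnePVM_eigenPVM hA).effect_ne_zero i
    have hp := hρ.bornProb_pos h0
    have hq := hσ.bornProb_pos h0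
    have h1 : Real.log (hA.eigenvalues i) - logRatio ρ σ (eigenPVM hA, i) ≤
        bornProb σ (eigenPVM hA) i * hA.eigenvalues i / bornProb ρ (eigenPVM hA) i - 1 := by
      have h2 := Real.log_le_sub_one_of_pos (div_pos (mul_pos hq (ha i)) hp)
      rw [Real.log_div (mul_pos hq (ha i)).ne' hp.ne', Real.log_mul hq.ne' (ha i).ne'] at h2
      simp only [logRatio]
      rw [Real.log_div hp.ne' hq.ne']
      linarith
    have h3 := mul_le_mul_of_nonneg_left h1 hp.le
    rw [mul_sub, mul_sub, mul_one, mul_div_cancel₀ _ hp.ne'] at h3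
    linarith
  have hsum := Finset.sum_le_sum fun i (_ : i ∈ Finset.univ) => hgibbs i
  rw [Finset.sum_add_distrib, Finset.sum_sub_distrib, hnorm, bornProb_sum, sub_self, add_zero]
    at hsum
  rw [hleft]
  exact hlog.trans hsum

theorem ofReal_outcomeRelEntropy_le {ρ σ : QState d} (hρ : ρ.FullSupport) (hσ : σ.FullSupport)
    (m : POVM d r) : ENNReal.ofReal (outcomeRelEntropy ρ σ m) ≤ measuredRelEntropy ρ σ := by
  obtain ⟨e, he, hle⟩ := exists_isRankOnePVM_outcomeRelEntropy_le hρ hσ m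
  rw [measuredRelEntropy_eq_iSup ρ hσ]
  exact (ENNReal.ofReal_le_ofReal hle).trans
    (le_iSup₂ (f := fun (m : POVM d d) (_ : m.IsRankOnePVM) =>
      ENNReal.ofReal (outcomeRelEntropy ρ σ m)) e he)

/-! ### Strict positivity of the measured relative entropy -/

theorem bornProb_eq_of_outcomeRelEntropy_eq_zero {ρ σ : QState d} (hρ : ρ.FullSupport)
    (hσ : σ.FullSupport) {m : POVM d r} (h : outcomeRelEntropy ρ σ m = 0) (x : Fin r) :
    bornProb ρ m x = bornProb σ m x := by
  have hnn : ∀ x, 0 ≤ bornProb ρ m x *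
      (Real.exp (-logRatio ρ σ (m, x)) - (-logRatio ρ σ (m, x) + 1)) := fun x =>
    mul_nonneg (bornProb_nonneg ρ m x) (sub_nonneg.mpr (Real.add_one_le_exp _))
  have h0 : ∑ x, bornProb ρ m x *
      (Real.exp (-logRatio ρ σ (m, x)) - (-logRatio ρ σ (m, x) + 1)) = 0 := by
    have h1 : ∀ x, bornProb ρ m x *
        (Real.exp (-logRatio ρ σ (m, x)) - (-logRatio ρ σ (m, x) + 1)) =
        bornProb σ m x + bornProb ρ m x * logRatio ρ σ (m, x) - bornProb ρ m x := by
      intro x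
      rw [mul_sub, bornProb_mul_exp_neg_logRatio hρ hσ]
      ring
    rw [Finset.sum_congr rfl fun x _ => h1 x, Finset.sum_sub_distrib, Finset.sum_add_distrib,
      bornProb_sum, bornProb_sum]
    simpa [outcomeRelEntropy] using h
  rw [Finset.sum_eq_zero_iff_of_nonneg fun x _ => hnn x] at h0
  have h2 := bornProb_mul_exp_neg_logRatio hρ hσ m x
  rcases mul_eq_zero.mp (h0 x (Finset.mem_univ x)) with h1 | h1
  · rw [← h2, h1, zero_mul]
  · have h3 : logRatio ρ σ (m, x) = 0 := by
      by_contra hne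
      have := Real.add_one_lt_exp (neg_ne_zero.mpr hne)
      linarith
    rw [← h2, h3]
    simp

/-- In an eigenbasis of `ρ - σ` the eigenvalues are the differences of the outcome probabilities. If
no measurement separates the states, all of them vanish. -/
theorem measuredRelEntropy_pos {ρ σ : QState d} (hρ : ρ.FullSupport) (hσ : σ.FullSupport)
    (hne : ρ ≠ σ) : 0 < measuredRelEntropy ρ σ := by
  by_contra h0
  have hA : (ρ.mat - σ.mat).IsHermitian := ρ.posSemidef.isHermitian.sub σ.posSemidef.isHermitian
  have h1 : outcomeRelEntropy ρ σ (eigenPVM hA) = 0 := by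
    refine le_antisymm ?_ (outcomeRelEntropy_nonneg hρ hσ _)
    rw [← ENNReal.ofReal_eq_zero]
    exact le_antisymm ((ofReal_outcomeRelEntropy_le hρ hσ _).trans (not_lt.mp h0)) zero_le
  have h2 : ∀ i, hA.eigenvalues i = 0 := by
    intro i
    have h3 := bornProb_eq_of_outcomeRelEntropy_eq_zero hρ hσ h1 i
    have h4 : (∑ j, ((hA.eigenvalues j * (Pi.single i 1 : Fin d → ℝ) j : ℝ) : ℂ) •
        eigenProj hA j) = (ρ.mat - σ.mat) * eigenProj hA i := by
      have h5 := sum_smul_eigenProj_mul hA (fun j => (hA.eigenvalues j : ℂ))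
        (fun j => ((Pi.single i 1 : Fin d → ℝ) j : ℂ))
      rw [sum_eigenvalues_smul_eigenProj] at h5
      simp only [Complex.ofReal_mul, ← h5]
      simp [Pi.single_apply, ite_smul]
    have h6 := congrArg (fun B => B.trace.re) h4
    simp only [Matrix.sub_mul, Matrix.trace_sub, Complex.sub_re] at h6
    have h7 : (ρ.mat * eigenProj hA i).trace.re - (σ.mat * eigenProj hA i).trace.re = 0 :=
      sub_eq_zero.mpr h3
    rw [h7] at h6
    simpa [Matrix.trace_sum, trace_eigenProj, Pi.single_apply] using h6
  have h3 := sum_eigenvalues_smul_eigenProj hA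
  simp only [h2, Complex.ofReal_zero, zero_smul, Finset.sum_const_zero] at h3
  have h4 : ρ.mat = σ.mat := (sub_eq_zero.mp h3.symm)
  apply hne
  cases ρ; cases σ
  simp only at h4
  subst h4
  rfl

end Optimality

end SeqQHT

namespace SeqQHT

/-! ### The law of a sequential test -/

section Law

open Preorder

variable {d r : ℕ}

namespace SQHT

variable (S : SQHT d r)

instance (ρ : QState d) : IsProbabilityMeasure (S.law ρ) := by
  unfold law; infer_instance

theorem map_eval_zero_law (ρ : QState d) :
    (S.law ρ).map (fun ω => ω 0) = S.init ⊗ₘ bornKernel ρ := by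
  have h1 : (S.law ρ).map (frestrictLe 0) =
      (S.init ⊗ₘ bornKernel ρ).map
        (MeasurableEquiv.piUnique fun _ : Finset.Iic 0 => POVM d r × Fin r).symm := by
    unfold law Kernel.trajMeasure
    rw [Measure.map_comp _ _ (by fun_prop), Kernel.traj_map_frestrictLe, Kernel.partialTraj_self,
      Measure.id_comp]
  have h2 : (fun ω : Path d r => ω 0) =
      (MeasurableEquiv.piUnique fun _ : Finset.Iic 0 => POVM d r × Fin r) ∘ frestrictLe 0 := rfl
  rw [h2, ← Measure.map_map (by fun_prop) (by fun_prop), h1, Measure.map_map (by fun_prop)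
    (by fun_prop), MeasurableEquiv.self_comp_symm, Measure.map_id]

theorem map_frestrictLe_prod_law (ρ : QState d) (k : ℕ) :
    (S.law ρ).map (fun ω => ((frestrictLe k ω : History d r k), ω (k + 1))) =
      (S.law ρ).map (frestrictLe k) ⊗ₘ S.step ρ k :=
  Kernel.map_frestrictLe_trajMeasure_compProd_eq_map_trajMeasure.symm

theorem lintegral_step (ρ : QState d) (k : ℕ) (h : History d r k) {f : POVM d r × Fin r → ℝ≥0∞}
    (hf : Measurable f) :
    ∫⁻ y, f y ∂(S.step ρ k h) =
      ∫⁻ m, ∑ x, ENNReal.ofReal (bornProb ρ m x) * f (m, x) ∂(S.next k h) := by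
  unfold step
  rw [Kernel.lintegral_compProd _ _ _ hf]
  refine lintegral_congr fun m => ?_
  rw [Kernel.prodMkLeft_apply]
  exact lintegral_bornKernel ρ m fun x => f (m, x)

/-- The joint law of the past and the next round is a composition-product, so the next round can be
integrated out first. -/
theorem lintegral_law_succ (ρ : QState d) (k : ℕ)
    {F : History d r k × (POVM d r × Fin r) → ℝ≥0∞} (hF : Measurable F) :
    ∫⁻ ω, F (frestrictLe k ω, ω (k + 1)) ∂(S.law ρ) =
      ∫⁻ ω, ∫⁻ y, F (frestrictLe k ω, y) ∂(S.step ρ k (frestrictLe k ω)) ∂(S.law ρ) := by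
  have h1 : ∫⁻ ω, F (frestrictLe k ω, ω (k + 1)) ∂(S.law ρ) =
      ∫⁻ z, F z ∂((S.law ρ).map (fun ω => ((frestrictLe k ω : History d r k), ω (k + 1)))) :=
    (lintegral_map hF (by fun_prop)).symm
  rw [h1, map_frestrictLe_prod_law, Measure.lintegral_compProd hF,
    lintegral_map hF.lintegral_kernel_prod_right' (by fun_prop)]

theorem lintegral_law_zero (ρ : QState d) {f : POVM d r × Fin r → ℝ≥0∞} (hf : Measurable f) :
    ∫⁻ ω, f (ω 0) ∂(S.law ρ) =
      ∫⁻ m, ∑ x, ENNReal.ofReal (bornProb ρ m x) * f (m, x) ∂S.init := by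
  have h1 : ∫⁻ ω, f (ω 0) ∂(S.law ρ) = ∫⁻ z, f z ∂((S.law ρ).map (fun ω => ω 0)) :=
    (lintegral_map hf (by fun_prop)).symm
  rw [h1, map_eval_zero_law, Measure.lintegral_compProd hf]
  exact lintegral_congr fun m => lintegral_bornKernel ρ m fun x => f (m, x)

theorem integral_law_zero {ρ σ : QState d} (hρ : ρ.FullSupport) (hσ : σ.FullSupport) :
    ∫ ω, logRatio ρ σ (ω 0) ∂(S.law ρ) = ∫ m, outcomeRelEntropy ρ σ m ∂S.init := by
  obtain ⟨C, -, hC⟩ := exists_abs_logRatio_le hρ hσ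
  have hm := measurable_logRatio (r := r) ρ σ
  have h1 : ∫ ω, logRatio ρ σ (ω 0) ∂(S.law ρ) =
      ∫ z, logRatio ρ σ z ∂((S.law ρ).map (fun ω => ω 0)) :=
    (integral_map (measurable_pi_apply 0).aemeasurable hm.aestronglyMeasurable).symm
  rw [h1, map_eval_zero_law, Measure.integral_compProd
    (Integrable.of_bound hm.aestronglyMeasurable C (ae_of_all _ fun y => hC y))]
  exact integral_congr_ae (ae_of_all _ fun m => integral_bornKernel ρ m fun x => _)

theorem integral_step_logRatio {ρ σ : QState d} (hρ : ρ.FullSupport) (hσ : σ.FullSupport)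
    (k : ℕ) (h : History d r k) :
    ∫ y, logRatio ρ σ y ∂(S.step ρ k h) = ∫ m, outcomeRelEntropy ρ σ m ∂(S.next k h) := by
  obtain ⟨C, -, hC⟩ := exists_abs_logRatio_le hρ hσ
  have hm := measurable_logRatio (r := r) ρ σ
  have hi : Integrable (logRatio ρ σ) (S.step ρ k h) :=
    Integrable.of_bound hm.aestronglyMeasurable C (ae_of_all _ fun y => hC y)
  unfold step at hi ⊢
  rw [ProbabilityTheory.integral_compProd hi]
  refine integral_congr_ae (ae_of_all _ fun m => ?_)
  simp only [Kernel.prodMkLeft_apply]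
  exact integral_bornKernel ρ m fun x => _

/-- The martingale step behind Wald's identity: on an event of the past, an increment may be
replaced by its conditional mean. -/
theorem integral_indicator_logRatio_succ {ρ σ : QState d} (hρ : ρ.FullSupport)
    (hσ : σ.FullSupport) (k : ℕ) {A : Set (History d r k)} (hA : MeasurableSet A) :
    ∫ ω, (frestrictLe k ⁻¹' A).indicator (fun ω => logRatio ρ σ (ω (k + 1))) ω ∂(S.law ρ) =
      ∫ ω, (frestrictLe k ⁻¹' A).indicator (fun ω =>
        ∫ m, outcomeRelEntropy ρ σ m ∂(S.next k (frestrictLe k ω))) ω ∂(S.law ρ) := by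
  obtain ⟨C, hC0, hC⟩ := exists_abs_logRatio_le hρ hσ
  set F : History d r k × (POVM d r × Fin r) → ℝ :=
    (Prod.fst ⁻¹' A).indicator fun z => logRatio ρ σ z.2 with hF
  have hm : Measurable F :=
    ((measurable_logRatio ρ σ).comp measurable_snd).indicator (measurable_fst hA)
  have hbd : ∀ z, ‖F z‖ ≤ C := fun z => by
    by_cases hz : z.1 ∈ A
    · simpa [hF, hz] using hC z.2
    · simpa [hF, hz] using hC0
  have hT : Measurable fun ω : Path d r => ((frestrictLe k ω : History d r k), ω (k + 1)) := by
    fun_prop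
  have h1 : ∫ ω, (frestrictLe k ⁻¹' A).indicator (fun ω => logRatio ρ σ (ω (k + 1))) ω
      ∂(S.law ρ) = ∫ z, F z
        ∂((S.law ρ).map (fun ω => ((frestrictLe k ω : History d r k), ω (k + 1)))) :=
    (integral_map hT.aemeasurable hm.aestronglyMeasurable).symm
  have hi : Integrable F ((S.law ρ).map (frestrictLe k) ⊗ₘ S.step ρ k) := by
    have : IsProbabilityMeasure ((S.law ρ).map (frestrictLe (π := fun _ => POVM d r × Fin r) k)) :=
      Measure.isProbabilityMeasure_map (by fun_prop)
    exact Integrable.of_bound hm.aestronglyMeasurable C (ae_of_all _ hbd)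
  rw [h1, map_frestrictLe_prod_law, Measure.integral_compProd hi, integral_map (by fun_prop)
    (hm.stronglyMeasurable.integral_kernel_prod_right' (κ := S.step ρ k)).aestronglyMeasurable]
  refine integral_congr_ae (ae_of_all _ fun ω => ?_)
  by_cases hω : frestrictLe k ω ∈ A
  · simp only [hF, Set.indicator, Set.mem_preimage, hω, if_true]
    exact S.integral_step_logRatio hρ hσ k _
  · simp [hF, hω]

end SQHT

/-- Extend a history by one round. -/
def History.append (k : ℕ) (z : History d r k × (POVM d r × Fin r)) : History d r (k + 1) :=
  fun i => if h : (i : ℕ) ∈ Finset.Iic k then z.1 ⟨i, h⟩ else z.2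

theorem History.measurable_append (k : ℕ) : Measurable (History.append (d := d) (r := r) k) := by
  refine measurable_pi_iff.mpr fun i => ?_
  unfold History.append
  split_ifs with h
  · fun_prop
  · fun_prop

theorem History.append_frestrictLe (k : ℕ) (ω : Path d r) :
    History.append k (frestrictLe k ω, ω (k + 1)) = frestrictLe (k + 1) ω := by
  funext i
  unfold History.append
  split_ifs with h
  · rfl
  · have h1 := Finset.mem_Iic.mp i.2
    rw [Finset.mem_Iic] at h
    have h2 : (i : ℕ) = k + 1 := by omega
    simp [h2]

/-- The log-likelihood ratio of a history. -/
noncomputable def logLik (ρ σ : QState d) (k : ℕ) (h : History d r k) : ℝ :=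
  ∑ i, logRatio ρ σ (h i)

theorem measurable_logLik (ρ σ : QState d) (k : ℕ) : Measurable (logLik (r := r) ρ σ k) :=
  Finset.measurable_sum _ fun i _ => (measurable_logRatio ρ σ).comp (measurable_pi_apply i)

theorem logLik_swap (ρ σ : QState d) (k : ℕ) (h : History d r k) :
    logLik σ ρ k h = -logLik ρ σ k h := by
  unfold logLik
  simp only [logRatio_swap ρ σ, Finset.sum_neg_distrib]

theorem logLik_frestrictLe (ρ σ : QState d) (k : ℕ) (ω : Path d r) :
    logLik ρ σ k (frestrictLe k ω) = ∑ i ∈ Finset.range (k + 1), logRatio ρ σ (ω i) := by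
  have h : Finset.range (k + 1) = Finset.Iic k := by ext; simp
  rw [h]
  exact Finset.sum_coe_sort (Finset.Iic k) fun i => logRatio ρ σ (ω i)

theorem logLik_frestrictLe_zero (ρ σ : QState d) (ω : Path d r) :
    logLik ρ σ 0 (frestrictLe 0 ω) = logRatio ρ σ (ω 0) := by
  rw [logLik_frestrictLe]; simp

theorem logLik_frestrictLe_succ (ρ σ : QState d) (k : ℕ) (ω : Path d r) :
    logLik ρ σ (k + 1) (frestrictLe (k + 1) ω) =
      logLik ρ σ k (frestrictLe k ω) + logRatio ρ σ (ω (k + 1)) := by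
  rw [logLik_frestrictLe, logLik_frestrictLe, Finset.sum_range_succ]

theorem ofReal_bornProb_mul_exp {ρ σ : QState d} (hρ : ρ.FullSupport) (hσ : σ.FullSupport)
    (m : POVM d r) (x : Fin r) :
    ENNReal.ofReal (bornProb ρ m x) * ENNReal.ofReal (Real.exp (-logRatio ρ σ (m, x))) =
      ENNReal.ofReal (bornProb σ m x) := by
  rw [← ENNReal.ofReal_mul (bornProb_nonneg ρ m x), bornProb_mul_exp_neg_logRatio hρ hσ]

namespace SQHT

variable (S : SQHT d r)

/-- Change of measure between the laws of a test in the states `ρ` and `σ`. -/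
theorem lintegral_law_change {ρ σ : QState d} (hρ : ρ.FullSupport) (hσ : σ.FullSupport) (k : ℕ)
    {f : History d r k → ℝ≥0∞} (hf : Measurable f) :
    ∫⁻ ω, f (frestrictLe k ω) ∂(S.law σ) =
      ∫⁻ ω, f (frestrictLe k ω) *
        ENNReal.ofReal (Real.exp (-logLik ρ σ k (frestrictLe k ω))) ∂(S.law ρ) := by
  induction k with
  | zero =>
    set e := (MeasurableEquiv.piUnique fun _ : Finset.Iic 0 => POVM d r × Fin r).symm with he
    have h1 : ∀ ω : Path d r, f (frestrictLe 0 ω) = (f ∘ e) (ω 0) := fun ω => by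
      rw [Function.comp_apply]
      congr 1
      exact (e.apply_symm_apply (frestrictLe 0 ω)).symm
    have hfe : Measurable (f ∘ e) := hf.comp e.measurable
    simp only [logLik_frestrictLe_zero, h1]
    rw [S.lintegral_law_zero σ hfe, S.lintegral_law_zero ρ
      (f := fun y => (f ∘ e) y * ENNReal.ofReal (Real.exp (-logRatio ρ σ y)))
      (hfe.mul (measurable_logRatio ρ σ).neg.exp.ennreal_ofReal)]
    refine lintegral_congr fun m => Finset.sum_congr rfl fun x _ => ?_
    rw [← ofReal_bornProb_mul_exp hρ hσ]
    ring
  | succ k ih =>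
    set F : History d r k × (POVM d r × Fin r) → ℝ≥0∞ := fun z => f (History.append k z)
    have hF : Measurable F := hf.comp (History.measurable_append k)
    have hE : Measurable fun y : POVM d r × Fin r =>
        ENNReal.ofReal (Real.exp (-logRatio ρ σ y)) :=
      (measurable_logRatio ρ σ).neg.exp.ennreal_ofReal
    have hL : Measurable fun h : History d r k => ENNReal.ofReal (Real.exp (-logLik ρ σ k h)) :=
      (measurable_logLik ρ σ k).neg.exp.ennreal_ofReal
    have h1 : ∀ ω : Path d r, f (frestrictLe (k + 1) ω) = F (frestrictLe k ω, ω (k + 1)) :=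
      fun ω => by rw [← History.append_frestrictLe]
    simp only [h1, logLik_frestrictLe_succ, neg_add, Real.exp_add]
    rw [S.lintegral_law_succ σ k hF, ih (f := fun h => ∫⁻ y, F (h, y) ∂(S.step σ k h))
      hF.lintegral_kernel_prod_right']
    have h2 := S.lintegral_law_succ ρ k (F := fun z => F z *
      (ENNReal.ofReal (Real.exp (-logLik ρ σ k z.1)) *
        ENNReal.ofReal (Real.exp (-logRatio ρ σ z.2))))
      (hF.mul ((hL.comp measurable_fst).mul (hE.comp measurable_snd)))
    simp only [ENNReal.ofReal_mul (Real.exp_nonneg _)]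
    rw [h2]
    refine lintegral_congr fun ω => ?_
    have hFω : Measurable fun y => F (frestrictLe k ω, y) := hF.comp measurable_prodMk_left
    have h3 : ∀ y, F (frestrictLe k ω, y) *
        (ENNReal.ofReal (Real.exp (-logLik ρ σ k (frestrictLe k ω))) *
          ENNReal.ofReal (Real.exp (-logRatio ρ σ y))) =
        ENNReal.ofReal (Real.exp (-logLik ρ σ k (frestrictLe k ω))) *
          (F (frestrictLe k ω, y) * ENNReal.ofReal (Real.exp (-logRatio ρ σ y))) := fun y => by ring
    simp only [h3]
    have hFE : Measurable fun y => F (frestrictLe k ω, y) *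
        ENNReal.ofReal (Real.exp (-logRatio ρ σ y)) := hFω.mul hE
    rw [lintegral_const_mul _ hFE, mul_comm]
    congr 1
    -- The choice of the POVM given the past does not depend on the state, so only the Born
    -- probabilities are reweighted.
    rw [S.lintegral_step σ k _ hFω, S.lintegral_step ρ k _ hFE]
    refine lintegral_congr fun m => Finset.sum_congr rfl fun x _ => ?_
    rw [← ofReal_bornProb_mul_exp hρ hσ]
    ring

theorem law_preimage_eq_setLIntegral {ρ σ : QState d} (hρ : ρ.FullSupport) (hσ : σ.FullSupport)
    (k : ℕ) {A : Set (History d r k)} (hA : MeasurableSet A) :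
    S.law σ (frestrictLe k ⁻¹' A) =
      ∫⁻ ω in frestrictLe k ⁻¹' A,
        ENNReal.ofReal (Real.exp (-logLik ρ σ k (frestrictLe k ω))) ∂(S.law ρ) := by
  have hA' : MeasurableSet (frestrictLe (π := fun _ => POVM d r × Fin r) k ⁻¹' A) :=
    (measurable_frestrictLe k) hA
  have h := S.lintegral_law_change hρ hσ k (f := A.indicator 1) (measurable_one.indicator hA)
  rw [← lintegral_indicator_one hA', ← lintegral_indicator hA']
  refine Eq.trans h (lintegral_congr fun ω => ?_)
  by_cases hω : frestrictLe k ω ∈ A <;> simp [hω]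

/-! ### Stopping events and the stopped log-likelihood ratio -/

/-- The histories along which no decision is taken. -/
def undecidedHist (k : ℕ) : Set (History d r k) :=
  {h | ∀ j (hj : j ≤ k), S.decision j (frestrictLe₂ (π := fun _ => POVM d r × Fin r) hj h) = none}

/-- The histories along which the first decision is taken in the last round, and is `a`. -/
def declaresHist (a : Fin 2) (k : ℕ) : Set (History d r k) :=
  {h | (∀ j (hj : j < k), S.decision j (frestrictLe₂ (π := fun _ => POVM d r × Fin r) hj.le h) = none) ∧
    S.decision k h = some a}

theorem measurableSet_undecidedHist (k : ℕ) : MeasurableSet (S.undecidedHist k) := by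
  unfold undecidedHist
  simp only [Set.ofPred_forall]
  exact MeasurableSet.iInter fun j => MeasurableSet.iInter fun hj =>
    (measurable_frestrictLe₂ (X := fun _ => POVM d r × Fin r) hj
      (S.measurableSet_decision j none) :)

theorem measurableSet_declaresHist (a : Fin 2) (k : ℕ) : MeasurableSet (S.declaresHist a k) := by
  unfold declaresHist
  rw [Set.ofPred_and]
  refine MeasurableSet.inter ?_ (S.measurableSet_decision k (some a))
  simp only [Set.ofPred_forall]
  exact MeasurableSet.iInter fun j => MeasurableSet.iInter fun hj =>
    (measurable_frestrictLe₂ (X := fun _ => POVM d r × Fin r) hj.le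
      (S.measurableSet_decision j none) :)

/-- The event that no decision is taken in the rounds `0, …, k`. -/
def undecided (k : ℕ) : Set (Path d r) := frestrictLe k ⁻¹' S.undecidedHist k

/-- The event that the test stops after round `k` and declares `a`. -/
def declaresAt (a : Fin 2) (k : ℕ) : Set (Path d r) := frestrictLe k ⁻¹' S.declaresHist a k

theorem mem_undecided {k : ℕ} {ω : Path d r} :
    ω ∈ S.undecided k ↔ ∀ j ≤ k, S.decisionAt j ω = none := Iff.rfl

theorem mem_declaresAt {a : Fin 2} {k : ℕ} {ω : Path d r} :
    ω ∈ S.declaresAt a k ↔ (∀ j < k, S.decisionAt j ω = none) ∧ S.decisionAt k ω = some a :=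
  Iff.rfl

theorem measurableSet_undecided (k : ℕ) : MeasurableSet (S.undecided k) :=
  measurable_frestrictLe k (S.measurableSet_undecidedHist k)

theorem measurableSet_declaresAt (a : Fin 2) (k : ℕ) : MeasurableSet (S.declaresAt a k) :=
  measurable_frestrictLe k (S.measurableSet_declaresHist a k)

theorem declares_eq_iUnion (a : Fin 2) : S.declares a = ⋃ k, S.declaresAt a k := by
  ext ω
  simp [declares, mem_declaresAt]

theorem pairwise_disjoint_declaresAt (a : Fin 2) :
    Pairwise (Function.onFun Disjoint (S.declaresAt a)) := by
  have key : ∀ i j, i < j → Disjoint (S.declaresAt a i) (S.declaresAt a j) := fun i j hij =>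
    Set.disjoint_left.mpr fun ω h1 h2 => by
      rw [mem_declaresAt] at h1 h2
      rw [h2.1 i hij] at h1
      exact absurd h1.2 (by simp)
  intro i j hij
  rcases lt_or_gt_of_ne hij with h | h
  · exact key i j h
  · exact (key j i h).symm

/-- Tail-sum formula. Round `0` always uses one sample, and being undecided through round `k` forces
one more; the identity includes paths that never stop. -/
theorem stopTime_eq_tsum (ω : Path d r) :
    (S.stopTime ω : ℝ≥0∞) = 1 + ∑' k, (S.undecided k).indicator 1 ω := by
  classical
  by_cases h : ∃ k, S.decisionAt k ω ≠ none
  · have h1 : S.stopTime ω = ((Nat.find h + 1 : ℕ) : ℕ∞) := by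
      unfold stopTime
      refine le_antisymm (iInf₂_le (Nat.find h) (Nat.find_spec h)) (le_iInf₂ fun k hk => ?_)
      exact_mod_cast Nat.succ_le_succ (Nat.find_min' h hk)
    have h2 : ∀ k, (S.undecided k).indicator (1 : Path d r → ℝ≥0∞) ω =
        if k < Nat.find h then 1 else 0 := by
      intro k
      have h3 : ω ∈ S.undecided k ↔ k < Nat.find h := by
        rw [mem_undecided, Nat.lt_find_iff]
        simp
      simp [Set.indicator, h3]
    rw [h1, tsum_congr h2, tsum_eq_sum (s := Finset.range (Nat.find h))
      (fun k hk => by simpa using hk)]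
    simp [add_comm]
    rw [Finset.filter_true_of_mem (fun k hk => by simpa using hk)]
    simp
  · have h1 : S.stopTime ω = ⊤ := by
      unfold stopTime
      simp only [iInf_eq_top]
      exact fun k hk => absurd ⟨k, hk⟩ h
    have h2 : ∀ k, (S.undecided k).indicator (1 : Path d r → ℝ≥0∞) ω = 1 := by
      intro k
      push Not at h
      rw [Set.indicator_of_mem (S.mem_undecided.mpr fun j _ => h j)]
      rfl
    rw [h1, tsum_congr h2, ENNReal.tsum_const_eq_top_of_ne_zero one_ne_zero]
    simp

theorem expectedTime_eq_tsum (ρ : QState d) :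
    S.expectedTime ρ = 1 + ∑' k, S.law ρ (S.undecided k) := by
  unfold expectedTime
  simp only [stopTime_eq_tsum]
  rw [lintegral_add_left measurable_const, lintegral_one, measure_univ,
    lintegral_tsum fun k => (measurable_one.indicator (S.measurableSet_undecided k)).aemeasurable]
  congr 1
  exact tsum_congr fun k => lintegral_indicator_one (S.measurableSet_undecided k)

/-- The log-likelihood ratio of the rounds `0, …, k` that precede the decision. -/
noncomputable def stoppedLogLik (ρ σ : QState d) (k : ℕ) (ω : Path d r) : ℝ :=
  logRatio ρ σ (ω 0) +
    ∑ j ∈ Finset.range k, (S.undecided j).indicator (fun ω => logRatio ρ σ (ω (j + 1))) ω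

theorem measurable_stoppedLogLik (ρ σ : QState d) (k : ℕ) :
    Measurable (S.stoppedLogLik ρ σ k) :=
  ((measurable_logRatio ρ σ).comp (measurable_pi_apply 0)).add
    (Finset.measurable_sum _ fun j _ =>
      ((measurable_logRatio ρ σ).comp (measurable_pi_apply (j + 1))).indicator
        (S.measurableSet_undecided j))

theorem exists_abs_stoppedLogLik_le {ρ σ : QState d} (hρ : ρ.FullSupport) (hσ : σ.FullSupport)
    (k : ℕ) : ∃ C : ℝ, ∀ ω, |S.stoppedLogLik ρ σ k ω| ≤ C := by
  obtain ⟨C, hC0, hC⟩ := exists_abs_logRatio_le hρ hσ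
  refine ⟨C + ∑ j ∈ Finset.range k, C, fun ω => ?_⟩
  refine (abs_add_le _ _).trans (add_le_add (hC _) ?_)
  refine (Finset.abs_sum_le_sum_abs _ _).trans (Finset.sum_le_sum fun j _ => ?_)
  by_cases h : ω ∈ S.undecided j
  · simpa [h] using hC (ω (j + 1))
  · simpa [h] using hC0

/-- Round `i + 1` is counted exactly when the test is undecided through round `i`, so a decision in
round `j` freezes the sum with round `j` included. -/
theorem stoppedLogLik_of_forall_undecided (ρ σ : QState d) {j k : ℕ} (hjk : j ≤ k)
    {ω : Path d r} (h1 : ∀ i < j, ω ∈ S.undecided i) (h2 : ∀ i, j ≤ i → i < k → ω ∉ S.undecided i) :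
    S.stoppedLogLik ρ σ k ω = logLik ρ σ j (frestrictLe j ω) := by
  rw [logLik_frestrictLe, Finset.sum_range_succ', add_comm, stoppedLogLik]
  congr 1
  rw [← Finset.sum_subset (Finset.range_mono hjk)]
  · exact Finset.sum_congr rfl fun i hi => by rw [Set.indicator_of_mem (h1 i (by simpa using hi))]
  · intro i hi hi'
    rw [Set.indicator_of_notMem (h2 i (by simpa using hi') (by simpa using hi))]

theorem stoppedLogLik_of_mem_declaresAt (ρ σ : QState d) {a : Fin 2} {j k : ℕ} (hjk : j ≤ k)
    {ω : Path d r} (h : ω ∈ S.declaresAt a j) :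
    S.stoppedLogLik ρ σ k ω = logLik ρ σ j (frestrictLe j ω) := by
  rw [mem_declaresAt] at h
  refine S.stoppedLogLik_of_forall_undecided ρ σ hjk
    (fun i hi => S.mem_undecided.mpr fun l hl => h.1 l (lt_of_le_of_lt hl hi)) fun i hi _ hu => ?_
  have := S.mem_undecided.mp hu j hi
  rw [h.2] at this
  simp at this

theorem stoppedLogLik_of_mem_undecided (ρ σ : QState d) {k : ℕ} {ω : Path d r}
    (h : ∀ i < k, ω ∈ S.undecided i) :
    S.stoppedLogLik ρ σ k ω = logLik ρ σ k (frestrictLe k ω) :=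
  S.stoppedLogLik_of_forall_undecided ρ σ le_rfl h fun _ hi hi' => absurd hi' (not_lt.mpr hi)

theorem undecided_antitone {i k : ℕ} (h : i ≤ k) : S.undecided k ⊆ S.undecided i :=
  fun _ hω j hj => hω j (hj.trans h)

/-- Wald's identity. Truncation at round `k` makes the stopped sum bounded, so no integrability of
the stopping time is needed. -/
theorem integral_stoppedLogLik {ρ σ : QState d} (hρ : ρ.FullSupport) (hσ : σ.FullSupport)
    (k : ℕ) :
    ∫ ω, S.stoppedLogLik ρ σ k ω ∂(S.law ρ) =
      ∫ m, outcomeRelEntropy ρ σ m ∂S.init +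
        ∑ j ∈ Finset.range k, ∫ ω, (S.undecided j).indicator (fun ω =>
          ∫ m, outcomeRelEntropy ρ σ m ∂(S.next j (frestrictLe j ω))) ω ∂(S.law ρ) := by
  obtain ⟨C, hC0, hC⟩ := exists_abs_logRatio_le hρ hσ
  have hi : ∀ j, Integrable (fun ω : Path d r => logRatio ρ σ (ω j)) (S.law ρ) := fun j =>
    Integrable.of_bound ((measurable_logRatio ρ σ).comp (measurable_pi_apply j)).aestronglyMeasurable
      C (ae_of_all _ fun ω => hC (ω j))
  have hi' : ∀ j, Integrable ((S.undecided j).indicator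
      fun ω : Path d r => logRatio ρ σ (ω (j + 1))) (S.law ρ) := fun j =>
    (hi (j + 1)).indicator (S.measurableSet_undecided j)
  unfold stoppedLogLik
  rw [integral_add (hi 0) (integrable_finsetSum _ fun j _ => hi' j),
    integral_finsetSum _ fun j _ => hi' j, S.integral_law_zero hρ hσ]
  congr 1
  exact Finset.sum_congr rfl fun j _ =>
    S.integral_indicator_logRatio_succ hρ hσ j (S.measurableSet_undecidedHist j)

end SQHT

end Law

end SeqQHT

namespace SeqQHT

/-! ### The converse -/

section Converse

open Preorder

variable {d r : ℕ}

namespace SQHT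

variable (S : SQHT d r)

/-- The event that the test declares `a` in one of the rounds `0, …, k`. -/
def declaresBy (a : Fin 2) (k : ℕ) : Set (Path d r) :=
  ⋃ j ∈ Finset.range (k + 1), S.declaresAt a j

theorem measurableSet_declaresBy (a : Fin 2) (k : ℕ) : MeasurableSet (S.declaresBy a k) :=
  Finset.measurableSet_biUnion _ fun j _ => S.measurableSet_declaresAt a j

theorem declaresBy_subset_declares (a : Fin 2) (k : ℕ) : S.declaresBy a k ⊆ S.declares a := by
  rw [declares_eq_iUnion]
  exact Set.iUnion₂_subset fun j _ => Set.subset_iUnion (S.declaresAt a) j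

theorem tendsto_law_declaresBy (ρ : QState d) (a : Fin 2) :
    Tendsto (fun k => S.law ρ (S.declaresBy a k)) atTop (𝓝 (S.law ρ (S.declares a))) := by
  have h := tendsto_measure_iUnion_accumulate (μ := S.law ρ) (f := S.declaresAt a)
  rw [← declares_eq_iUnion] at h
  refine h.congr fun k => ?_
  congr 1
  ext ω
  simp [declaresBy, Set.mem_accumulate]

theorem exists_mem_declaresBy_or_mem_undecided (k : ℕ) (ω : Path d r) :
    (∃ a, ω ∈ S.declaresBy a k) ∨ ω ∈ S.undecided k := by
  classical
  by_cases h : ∃ j, S.decisionAt j ω ≠ none ∧ j ≤ k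
  · left
    obtain ⟨a, ha⟩ := Option.ne_none_iff_exists'.mp (Nat.find_spec h).1
    refine ⟨a, Set.mem_biUnion (x := Nat.find h)
      (by simpa [Nat.lt_succ_iff] using (Nat.find_spec h).2) (S.mem_declaresAt.mpr ⟨?_, ha⟩)⟩
    intro j hj
    by_contra hne
    exact Nat.find_min h hj ⟨hne, hj.le.trans (Nat.find_spec h).2⟩
  · right
    intro j hj
    by_contra hne
    exact h ⟨j, hne, hj⟩

/-- Splitting by the round of the decision reduces to the change of measure at a fixed round. -/
theorem setLIntegral_declaresBy {ρ σ : QState d} (hρ : ρ.FullSupport) (hσ : σ.FullSupport)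
    (a : Fin 2) (k : ℕ) :
    ∫⁻ ω in S.declaresBy a k, ENNReal.ofReal (Real.exp (-S.stoppedLogLik ρ σ k ω)) ∂(S.law ρ) =
      S.law σ (S.declaresBy a k) := by
  have hd : Set.PairwiseDisjoint (↑(Finset.range (k + 1))) (S.declaresAt a) :=
    fun i _ j _ hij => S.pairwise_disjoint_declaresAt a hij
  unfold declaresBy
  rw [lintegral_biUnion_finset hd fun j _ => S.measurableSet_declaresAt a j,
    measure_biUnion_finset hd fun j _ => S.measurableSet_declaresAt a j]
  refine Finset.sum_congr rfl fun j hj => ?_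
  have hjk : j ≤ k := by simpa [Nat.lt_succ_iff] using hj
  refine Eq.trans ?_ (S.law_preimage_eq_setLIntegral hρ hσ j (S.measurableSet_declaresHist a j)).symm
  exact setLIntegral_congr_fun (S.measurableSet_declaresAt a j) fun ω hω => by
    simp only [S.stoppedLogLik_of_mem_declaresAt ρ σ hjk hω]

theorem setLIntegral_undecided {ρ σ : QState d} (hρ : ρ.FullSupport) (hσ : σ.FullSupport)
    (k : ℕ) :
    ∫⁻ ω in S.undecided k, ENNReal.ofReal (Real.exp (-S.stoppedLogLik ρ σ k ω)) ∂(S.law ρ) =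
      S.law σ (S.undecided k) := by
  refine Eq.trans ?_ (S.law_preimage_eq_setLIntegral hρ hσ k (S.measurableSet_undecidedHist k)).symm
  exact setLIntegral_congr_fun (S.measurableSet_undecided k) fun ω hω => by
    simp only [S.stoppedLogLik_of_mem_undecided ρ σ
      fun i hi => S.undecided_antitone hi.le hω]

/-- The two declarations and indecision cover everything and contribute at most `1` each. The sharp
value is `1`, but any constant is negligible against `n`. -/
theorem lintegral_exp_neg_stoppedLogLik_le {ρ σ : QState d} (hρ : ρ.FullSupport)
    (hσ : σ.FullSupport) (k : ℕ) :
    ∫⁻ ω, ENNReal.ofReal (Real.exp (-S.stoppedLogLik ρ σ k ω)) ∂(S.law ρ) ≤ 3 := by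
  have hcover : (Set.univ : Set (Path d r)) ⊆
      (S.declaresBy 0 k ∪ S.declaresBy 1 k) ∪ S.undecided k := by
    intro ω _
    rcases S.exists_mem_declaresBy_or_mem_undecided k ω with ⟨a, ha⟩ | h
    · fin_cases a
      · exact Or.inl (Or.inl ha)
      · exact Or.inl (Or.inr ha)
    · exact Or.inr h
  rw [← setLIntegral_univ]
  refine (lintegral_mono_set hcover).trans ((lintegral_union_le _ _ _).trans ?_)
  refine (add_le_add_left (lintegral_union_le _ _ _) _).trans ?_
  rw [S.setLIntegral_declaresBy hρ hσ, S.setLIntegral_declaresBy hρ hσ,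
    S.setLIntegral_undecided hρ hσ]
  refine (add_le_add (add_le_add prob_le_one prob_le_one) prob_le_one).trans ?_
  norm_num

/-- Data processing in a form that survives a zero error probability: the free `c` stands in for the
reciprocal of the error under `σ`. -/
theorem law_declaresBy_mul_log_le {ρ σ : QState d} (hρ : ρ.FullSupport) (hσ : σ.FullSupport)
    (a : Fin 2) (k : ℕ) {c : ℝ} (hc : 0 < c) :
    (S.law ρ).real (S.declaresBy a k) * Real.log c ≤
      ∫ ω, S.stoppedLogLik ρ σ k ω ∂(S.law ρ) + c * (S.law σ).real (S.declaresBy a k) + 3 := by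
  set Λ := S.stoppedLogLik ρ σ k with hΛ
  set A := S.declaresBy a k with hA
  have hAm : MeasurableSet A := S.measurableSet_declaresBy a k
  have hΛm : Measurable Λ := S.measurable_stoppedLogLik ρ σ k
  obtain ⟨C, hC⟩ := S.exists_abs_stoppedLogLik_le hρ hσ k
  have hΛi : Integrable Λ (S.law ρ) :=
    Integrable.of_bound hΛm.aestronglyMeasurable C (ae_of_all _ fun ω => hC ω)
  have hEm : Measurable fun ω => Real.exp (-Λ ω) := hΛm.neg.exp
  have hEi : Integrable (fun ω => Real.exp (-Λ ω)) (S.law ρ) := by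
    refine Integrable.of_bound hEm.aestronglyMeasurable (Real.exp C) (ae_of_all _ fun ω => ?_)
    rw [Real.norm_eq_abs, abs_of_pos (Real.exp_pos _), Real.exp_le_exp]
    exact (neg_le_abs _).trans (hC ω)
  -- Both cases are `t + 1 ≤ exp t`, at `log c - Λ` on `A` and at `-Λ` off `A`, where the second
  -- exponential pays for negative values of `Λ`.
  have hpt : ∀ ω, A.indicator (fun _ => Real.log c) ω -
      (c * A.indicator (fun ω => Real.exp (-Λ ω)) ω + Real.exp (-Λ ω)) ≤ Λ ω := by
    intro ω
    have hpos := Real.exp_pos (-Λ ω)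
    by_cases hω : ω ∈ A
    · simp only [hω, Set.indicator_of_mem]
      have h1 := Real.add_one_le_exp (Real.log c - Λ ω)
      rw [sub_eq_add_neg, Real.exp_add, Real.exp_log hc] at h1
      linarith
    · simp only [hω, not_false_eq_true, Set.indicator_of_notMem, mul_zero]
      have h1 := Real.add_one_le_exp (-Λ ω)
      linarith
  have hci : Integrable (A.indicator fun _ => Real.log c) (S.law ρ) :=
    (integrable_const (Real.log c)).indicator hAm
  have hsi : Integrable (fun ω => c * A.indicator (fun ω => Real.exp (-Λ ω)) ω + Real.exp (-Λ ω))
      (S.law ρ) := ((hEi.indicator hAm).const_mul c).add hEi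
  have hint := integral_mono (hci.sub hsi) hΛi hpt
  simp only [Pi.sub_apply] at hint
  rw [integral_sub hci hsi, integral_add ((hEi.indicator hAm).const_mul c) hEi, integral_const_mul,
    integral_indicator hAm, integral_indicator hAm, setIntegral_const, smul_eq_mul] at hint
  have h1 : ∫ ω in A, Real.exp (-Λ ω) ∂(S.law ρ) = (S.law σ).real A := by
    rw [integral_eq_lintegral_of_nonneg_ae (ae_of_all _ fun ω => (Real.exp_pos _).le)
      hEm.aestronglyMeasurable, S.setLIntegral_declaresBy hρ hσ]
    rfl
  have h2 : ∫ ω, Real.exp (-Λ ω) ∂(S.law ρ) ≤ 3 := by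
    rw [integral_eq_lintegral_of_nonneg_ae (ae_of_all _ fun ω => (Real.exp_pos _).le)
      hEm.aestronglyMeasurable]
    exact ENNReal.toReal_le_of_le_ofReal (by norm_num)
      (by simpa using S.lintegral_exp_neg_stoppedLogLik_le hρ hσ k)
  rw [h1] at hint
  linarith

theorem sum_law_undecided_le (ρ : QState d) (hT : S.expectedTime ρ ≠ ⊤) (k : ℕ) :
    1 + ∑ j ∈ Finset.range k, (S.law ρ).real (S.undecided j) ≤ (S.expectedTime ρ).toReal := by
  have h : 1 + ∑ j ∈ Finset.range k, S.law ρ (S.undecided j) ≤ S.expectedTime ρ := by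
    rw [expectedTime_eq_tsum]
    exact add_le_add_right (ENNReal.sum_le_tsum _) 1
  have h2 := ENNReal.toReal_mono hT h
  rwa [ENNReal.toReal_add ENNReal.one_ne_top
    (ENNReal.sum_ne_top.mpr fun j _ => measure_ne_top _ _), ENNReal.toReal_one,
    ENNReal.toReal_sum fun j _ => measure_ne_top _ _] at h2

theorem integrable_outcomeRelEntropy {ρ σ : QState d} (hρ : ρ.FullSupport) (hσ : σ.FullSupport)
    (μ : Measure (POVM d r)) [IsFiniteMeasure μ] : Integrable (outcomeRelEntropy ρ σ) μ := by
  obtain ⟨C, hC0, hC⟩ := exists_abs_logRatio_le hρ hσ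
  have hm : Measurable (outcomeRelEntropy (r := r) ρ σ) :=
    Finset.measurable_sum _ fun x _ => (measurable_bornProb ρ x).mul
      ((measurable_logRatio ρ σ).comp measurable_prodMk_right)
  refine Integrable.of_bound hm.aestronglyMeasurable C (ae_of_all _ fun m => ?_)
  rw [Real.norm_eq_abs, abs_of_nonneg (outcomeRelEntropy_nonneg hρ hσ m)]
  calc outcomeRelEntropy ρ σ m ≤ ∑ x, bornProb ρ m x * C :=
        Finset.sum_le_sum fun x _ => mul_le_mul_of_nonneg_left
          ((le_abs_self _).trans (hC (m, x))) (bornProb_nonneg ρ m x)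
    _ = C := by rw [← Finset.sum_mul, bornProb_sum, one_mul]

/-- An upper bound for the expected log-likelihood ratio at the decision. -/
theorem integral_stoppedLogLik_le {ρ σ : QState d} (hρ : ρ.FullSupport) (hσ : σ.FullSupport)
    {D : ℝ} (hD0 : 0 ≤ D) (hD : ∀ m : POVM d r, outcomeRelEntropy ρ σ m ≤ D)
    (hT : S.expectedTime ρ ≠ ⊤) (k : ℕ) :
    ∫ ω, S.stoppedLogLik ρ σ k ω ∂(S.law ρ) ≤ D * (S.expectedTime ρ).toReal := by
  have hle : ∀ (μ : Measure (POVM d r)) [IsProbabilityMeasure μ],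
      ∫ m, outcomeRelEntropy ρ σ m ∂μ ≤ D := fun μ _ => by
    have := integral_mono (integrable_outcomeRelEntropy hρ hσ μ) (integrable_const D) hD
    simpa using this
  refine le_trans ?_ (mul_le_mul_of_nonneg_left (S.sum_law_undecided_le ρ hT k) hD0)
  rw [S.integral_stoppedLogLik hρ hσ, mul_add, mul_one, Finset.mul_sum]
  refine add_le_add (hle _) (Finset.sum_le_sum fun j _ => ?_)
  have h1 : ∫ ω, (S.undecided j).indicator (fun _ => D) ω ∂(S.law ρ) =
      D * (S.law ρ).real (S.undecided j) := by
    rw [integral_indicator (S.measurableSet_undecided j), setIntegral_const, smul_eq_mul, mul_comm]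
  rw [← h1]
  refine integral_mono_of_nonneg (ae_of_all _ fun ω => ?_)
    ((integrable_const D).indicator (S.measurableSet_undecided j)) (ae_of_all _ fun ω => ?_)
  · exact Set.indicator_nonneg (fun ω _ => integral_nonneg fun m =>
      outcomeRelEntropy_nonneg hρ hσ m) ω
  · exact Set.indicator_le_indicator (hle _)

theorem law_declares_mul_log_le {ρ σ : QState d} (hρ : ρ.FullSupport) (hσ : σ.FullSupport)
    {D : ℝ} (hD0 : 0 ≤ D) (hD : ∀ m : POVM d r, outcomeRelEntropy ρ σ m ≤ D)
    (hT : S.expectedTime ρ ≠ ⊤) (a : Fin 2) {c : ℝ} (hc : 0 < c) :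
    (S.law ρ).real (S.declares a) * Real.log c ≤
      D * (S.expectedTime ρ).toReal + c * (S.law σ).real (S.declares a) + 3 := by
  have hlim : Tendsto (fun k => (S.law ρ).real (S.declaresBy a k) * Real.log c) atTop
      (𝓝 ((S.law ρ).real (S.declares a) * Real.log c)) :=
    ((ENNReal.tendsto_toReal (measure_ne_top _ _)).comp
      (S.tendsto_law_declaresBy ρ a)).mul_const _
  refine le_of_tendsto' hlim fun k => (S.law_declaresBy_mul_log_le hρ hσ a k hc).trans ?_
  have h1 := S.integral_stoppedLogLik_le hρ hσ hD0 hD hT k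
  have h2 : (S.law σ).real (S.declaresBy a k) ≤ (S.law σ).real (S.declares a) :=
    measureReal_mono (S.declaresBy_subset_declares a k)
  have h3 := mul_le_mul_of_nonneg_left h2 hc.le
  linarith

/-- A finite mean makes the probabilities of indecision summable, so the test stops almost surely.
-/
theorem one_le_law_declares_add (ρ : QState d) (hT : S.expectedTime ρ ≠ ⊤) :
    1 ≤ (S.law ρ).real (S.declares 0) + (S.law ρ).real (S.declares 1) := by
  have h0 : Tendsto (fun k => S.law ρ (S.undecided k)) atTop (𝓝 0) := by
    refine ENNReal.tendsto_atTop_zero_of_tsum_ne_top ?_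
    rw [expectedTime_eq_tsum] at hT
    exact (ENNReal.add_ne_top.mp hT).2
  have h1 : ∀ k, 1 ≤ (S.law ρ (S.declares 0) + S.law ρ (S.declares 1)) +
      S.law ρ (S.undecided k) := by
    intro k
    have hcover : (Set.univ : Set (Path d r)) ⊆
        (S.declares 0 ∪ S.declares 1) ∪ S.undecided k := by
      intro ω _
      rcases S.exists_mem_declaresBy_or_mem_undecided k ω with ⟨a, ha⟩ | h
      · have := S.declaresBy_subset_declares a k ha
        fin_cases a
        · exact Or.inl (Or.inl this)
        · exact Or.inl (Or.inr this)
      · exact Or.inr h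
    calc (1 : ℝ≥0∞) = S.law ρ Set.univ := measure_univ.symm
      _ ≤ _ := (measure_mono hcover).trans ((measure_union_le _ _).trans
        (add_le_add_left (measure_union_le _ _) _))
  have h2 : (1 : ℝ≥0∞) ≤ S.law ρ (S.declares 0) + S.law ρ (S.declares 1) := by
    have := ge_of_tendsto' (tendsto_const_nhds.add h0) h1
    simpa using this
  have h3 := ENNReal.toReal_mono (by finiteness) h2
  rwa [ENNReal.toReal_one, ENNReal.toReal_add (by finiteness) (by finiteness)] at h3

end SQHT

/-! ### From bounds at finite `n` to exponents -/

theorem le_ofReal_exp_of_lt_log {β : ℝ≥0∞} {n : ℕ} (hn : 0 < n) {R : ℝ} (hβ : β ≠ ⊤)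
    (h : (R : EReal) < ((1 / n : ℝ) : EReal) * ENNReal.log β⁻¹) :
    β ≤ ENNReal.ofReal (Real.exp (-(n * R))) := by
  rcases eq_or_ne β 0 with h0 | h0
  · simp [h0]
  · have hpos : 0 < β.toReal := ENNReal.toReal_pos h0 hβ
    have hn' : (0 : ℝ) < n := by exact_mod_cast hn
    rw [ENNReal.log_inv, ENNReal.log_pos_real h0 hβ, ← EReal.coe_neg, ← EReal.coe_mul,
      EReal.coe_lt_coe_iff, one_div, lt_inv_mul_iff₀ hn'] at h
    rw [← ENNReal.ofReal_toReal hβ]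
    refine ENNReal.ofReal_le_ofReal ?_
    rw [← Real.log_le_iff_le_exp hpos]
    linarith

theorem toReal_le_of_coe_sub_lt_one {E : ℝ≥0∞} {n : ℕ} (h : (E : EReal) - (n : EReal) < 1) :
    E ≠ ⊤ ∧ E.toReal ≤ n + 1 := by
  have hE : E ≠ ⊤ := by
    rintro rfl
    rw [EReal.coe_ennreal_top, show ((n : ℕ) : EReal) = ((n : ℝ) : EReal) from rfl,
      EReal.top_sub_coe] at h
    exact absurd h (by simp)
  refine ⟨hE, ?_⟩
  rw [← EReal.coe_toReal (x := (E : EReal)) (by simpa using hE) (by simp),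
    EReal.toReal_coe_ennreal, show ((n : ℕ) : EReal) = ((n : ℝ) : EReal) from rfl,
    ← EReal.coe_sub, ← EReal.coe_one, EReal.coe_lt_coe_iff] at h
  linarith

/-- The exponent of one of the error probabilities is at most the measured relative entropy. -/
theorem ofReal_exponent_le {ρ σ : QState d} (hρ : ρ.FullSupport) (hσ : σ.FullSupport)
    {r : ℕ → ℕ} (S : (n : ℕ) → SQHT d (r n)) {a b : Fin 2} (hab : a ≠ b) {R : ℝ}
    (hα : Tendsto (fun n => (S n).law ρ ((S n).declares b)) atTop (𝓝 0))
    (hβ : (R : EReal) ≤ liminf (fun n : ℕ =>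
      ((1 / n : ℝ) : EReal) * ENNReal.log ((S n).law σ ((S n).declares a))⁻¹) atTop)
    (hT : limsup (fun n : ℕ => ((S n).expectedTime ρ : EReal) - (n : EReal)) atTop ≤ 0) :
    ENNReal.ofReal R ≤ measuredRelEntropy ρ σ := by
  by_contra hlt
  rw [not_le] at hlt
  set D := (measuredRelEntropy ρ σ).toReal with hD_def
  have hDtop : measuredRelEntropy ρ σ ≠ ⊤ := hlt.ne_top
  have hD0 : 0 ≤ D := ENNReal.toReal_nonneg
  have hDR : D < R := by
    have hR : 0 < R := ENNReal.ofReal_pos.mp (pos_of_gt hlt)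
    have := (ENNReal.toReal_lt_toReal hDtop ENNReal.ofReal_ne_top).mpr hlt
    rwa [ENNReal.toReal_ofReal hR.le] at this
  have hD : ∀ (r : ℕ) (m : POVM d r), outcomeRelEntropy ρ σ m ≤ D := fun r m =>
    (ENNReal.ofReal_le_iff_le_toReal hDtop).mp (ofReal_outcomeRelEntropy_le hρ hσ m)
  obtain ⟨R', hDR', hRR'⟩ := exists_between hDR
  have hR' : 0 < R' := hD0.trans_lt hDR'
  have e1 : ∀ᶠ n : ℕ in atTop, (R' : EReal) <
      ((1 / n : ℝ) : EReal) * ENNReal.log ((S n).law σ ((S n).declares a))⁻¹ :=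
    eventually_lt_of_lt_liminf ((EReal.coe_lt_coe_iff.mpr hRR').trans_le hβ)
  have e2 : ∀ᶠ n : ℕ in atTop, ((S n).expectedTime ρ : EReal) - (n : EReal) < 1 :=
    eventually_lt_of_limsup_lt (hT.trans_lt zero_lt_one)
  -- With this bound on the failure probability, `(1 - ε) * n * R'` still exceeds `n * D` by `n *
  -- (R' - D) / 2`.
  have hε : 0 < (R' - D) / (2 * R') := div_pos (sub_pos.mpr hDR') (by linarith)
  have e3 : ∀ᶠ n : ℕ in atTop, (S n).law ρ ((S n).declares b) <
      ENNReal.ofReal ((R' - D) / (2 * R')) :=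
    hα.eventually_lt_const (ENNReal.ofReal_pos.mpr hε)
  -- `D` comes from `E[T] ≤ n + 1`, `1` from `c` times the error, and `3` from
  -- `law_declares_mul_log_le`.
  have e4 : ∀ᶠ n : ℕ in atTop, D + 4 < n * ((R' - D) / 2) :=
    (tendsto_natCast_atTop_atTop.atTop_mul_const
      (div_pos (sub_pos.mpr hDR') two_pos)).eventually_gt_atTop _
  obtain ⟨n, h1, h2, h3, h4, hn⟩ := (e1.and (e2.and (e3.and (e4.and (eventually_gt_atTop 0))))).exists
  obtain ⟨hTtop, hTn⟩ := toReal_le_of_coe_sub_lt_one h2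
  have hb := le_ofReal_exp_of_lt_log hn (measure_ne_top _ _) h1
  have hb' : ((S n).law σ).real ((S n).declares a) ≤ Real.exp (-(n * R')) :=
    ENNReal.toReal_le_of_le_ofReal (Real.exp_pos _).le hb
  have ha' : ((S n).law ρ).real ((S n).declares b) ≤ (R' - D) / (2 * R') :=
    ENNReal.toReal_le_of_le_ofReal hε.le h3.le
  have hsum : 1 ≤ ((S n).law ρ).real ((S n).declares a) +
      ((S n).law ρ).real ((S n).declares b) := by
    have := (S n).one_le_law_declares_add ρ hTtop
    fin_cases a <;> fin_cases b <;>
      first | exact absurd rfl hab | exact this | (rw [add_comm]; exact this)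
  have key := (S n).law_declares_mul_log_le hρ hσ hD0 (hD _) hTtop a (Real.exp_pos (n * R'))
  rw [Real.log_exp] at key
  have hn' : (0 : ℝ) < n := by exact_mod_cast hn
  have k1 : Real.exp (n * R') * ((S n).law σ).real ((S n).declares a) ≤ 1 := by
    refine (mul_le_mul_of_nonneg_left hb' (Real.exp_pos _).le).trans (le_of_eq ?_)
    rw [← Real.exp_add, add_neg_cancel, Real.exp_zero]
  have k2 : D * ((S n).expectedTime ρ).toReal ≤ D * (n + 1) := mul_le_mul_of_nonneg_left hTn hD0
  have k3 : (1 - (R' - D) / (2 * R')) * (n * R') ≤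
      ((S n).law ρ).real ((S n).declares a) * (n * R') :=
    mul_le_mul_of_nonneg_right (by linarith) (mul_pos hn' hR').le
  have k4 : (1 - (R' - D) / (2 * R')) * (n * R') = n * R' - n * ((R' - D) / 2) := by
    field_simp
  have k5 : n * R' - n * ((R' - D) / 2) = D * n + n * ((R' - D) / 2) := by ring
  linarith

theorem IsAchievable.le_measuredRelEntropy {ρ₀ ρ₁ : QState d} (h₀ : ρ₀.FullSupport)
    (h₁ : ρ₁.FullSupport) {R : ℝ × ℝ} (hR : IsAchievable ρ₀ ρ₁ R) :
    ENNReal.ofReal R.1 ≤ measuredRelEntropy ρ₁ ρ₀ ∧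
      ENNReal.ofReal R.2 ≤ measuredRelEntropy ρ₀ ρ₁ := by
  obtain ⟨-, -, r, S, hα, hβ, hR₁, hR₂, hT⟩ := hR
  have hmono : ∀ ρ, (∀ n, (S n).expectedTime ρ ≤
      max ((S n).expectedTime ρ₀) ((S n).expectedTime ρ₁)) →
      limsup (fun n : ℕ => ((S n).expectedTime ρ : EReal) - (n : EReal)) atTop ≤ 0 := by
    intro ρ hρ
    refine (limsup_le_limsup (Eventually.of_forall fun n => ?_)).trans hT
    exact EReal.sub_le_sub (EReal.coe_ennreal_le_coe_ennreal_iff.mpr (hρ n)) le_rfl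
  -- The exponent of the error under `ρ₀` is limited by the information gained while `ρ₁` is true,
  -- and vice versa.
  exact ⟨ofReal_exponent_le h₁ h₀ S one_ne_zero hβ hR₁ (hmono ρ₁ fun n => le_max_right _ _),
    ofReal_exponent_le h₀ h₁ S zero_ne_one hα hR₂ (hmono ρ₀ fun n => le_max_left _ _)⟩

end Converse

end SeqQHT

namespace SeqQHT

/-! ### Achievability -/

section Achievability

open Preorder

variable {d r : ℕ}

namespace SQHT

variable (S : SQHT d r)

/-- Wald's bound: where the test declares `a`, the density of the `σ`-law against the `ρ`-law is at
most `exp (-b)`. The disjoint rounds have total `ρ`-mass at most one. -/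
theorem law_declares_le_exp {ρ σ : QState d} (hρ : ρ.FullSupport) (hσ : σ.FullSupport)
    {a : Fin 2} {b : ℝ} (hb : ∀ k h, S.decision k h = some a → b ≤ logLik ρ σ k h) :
    S.law σ (S.declares a) ≤ ENNReal.ofReal (Real.exp (-b)) := by
  have h1 : ∀ k, S.law σ (S.declaresAt a k) ≤
      ENNReal.ofReal (Real.exp (-b)) * S.law ρ (S.declaresAt a k) := by
    intro k
    have h2 := S.law_preimage_eq_setLIntegral hρ hσ k (S.measurableSet_declaresHist a k)
    refine h2.le.trans ?_
    rw [← setLIntegral_const]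
    refine setLIntegral_mono' (S.measurableSet_declaresAt a k) fun ω hω => ?_
    exact ENNReal.ofReal_le_ofReal (Real.exp_le_exp.mpr (neg_le_neg (hb k _ hω.2)))
  rw [declares_eq_iUnion, measure_iUnion (S.pairwise_disjoint_declaresAt a)
    fun k => S.measurableSet_declaresAt a k]
  refine (ENNReal.tsum_le_tsum h1).trans ?_
  rw [ENNReal.tsum_mul_left, ← measure_iUnion (S.pairwise_disjoint_declaresAt a)
    fun k => S.measurableSet_declaresAt a k]
  exact mul_le_of_le_one_right' prob_le_one

theorem measurable_exp_neg_half_logRatio (ρ σ : QState d) :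
    Measurable fun y : POVM d r × Fin r =>
      ENNReal.ofReal (Real.exp (-(logRatio ρ σ y / 2))) :=
  ((measurable_logRatio ρ σ).div_const 2).neg.exp.ennreal_ofReal

theorem lintegral_dirac_exp_neg_half_logRatio (ρ σ : QState d) (m : POVM d r) :
    ∫⁻ m', ∑ x, ENNReal.ofReal (bornProb ρ m' x) *
      ENNReal.ofReal (Real.exp (-(logRatio ρ σ (m', x) / 2))) ∂(Measure.dirac m) =
      ENNReal.ofReal (fidelity ρ σ m) := by
  have hm : Measurable fun m' : POVM d r => ∑ x, ENNReal.ofReal (bornProb ρ m' x) *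
      ENNReal.ofReal (Real.exp (-(logRatio ρ σ (m', x) / 2))) :=
    Finset.measurable_sum _ fun x _ => (measurable_bornProb ρ x).ennreal_ofReal.mul
      ((measurable_exp_neg_half_logRatio ρ σ).comp measurable_prodMk_right)
  rw [lintegral_dirac' _ hm, fidelity,
    ENNReal.ofReal_sum_of_nonneg fun x _ =>
      mul_nonneg (bornProb_nonneg ρ m x) (Real.exp_nonneg _)]
  exact Finset.sum_congr rfl fun x _ => (ENNReal.ofReal_mul (bornProb_nonneg ρ m x)).symm

/-- Given the past, each round multiplies the exponential moment by the fidelity of its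
deterministic choice. -/
theorem lintegral_exp_neg_half_logLik_le {ρ σ : QState d} {φ : ℝ}
    (hinit : ∃ m, S.init = Measure.dirac m ∧ fidelity ρ σ m ≤ φ)
    (hnext : ∀ k h, ∃ m, S.next k h = Measure.dirac m ∧ fidelity ρ σ m ≤ φ) (k : ℕ) :
    ∫⁻ ω, ENNReal.ofReal (Real.exp (-(logLik ρ σ k (frestrictLe k ω) / 2))) ∂(S.law ρ) ≤
      ENNReal.ofReal φ ^ (k + 1) := by
  induction k with
  | zero =>
    simp only [logLik_frestrictLe_zero]
    rw [S.lintegral_law_zero ρ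
      (f := fun y => ENNReal.ofReal (Real.exp (-(logRatio ρ σ y / 2))))
      (measurable_exp_neg_half_logRatio ρ σ)]
    obtain ⟨m, hm, hle⟩ := hinit
    rw [hm, lintegral_dirac_exp_neg_half_logRatio, zero_add, pow_one]
    exact ENNReal.ofReal_le_ofReal hle
  | succ k ih =>
    have hE := measurable_exp_neg_half_logRatio (r := r) ρ σ
    have hL : Measurable fun h : History d r k =>
        ENNReal.ofReal (Real.exp (-(logLik ρ σ k h / 2))) :=
      ((measurable_logLik ρ σ k).div_const 2).neg.exp.ennreal_ofReal
    have h1 := S.lintegral_law_succ ρ k (F := fun z =>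
      ENNReal.ofReal (Real.exp (-(logLik ρ σ k z.1 / 2))) *
        ENNReal.ofReal (Real.exp (-(logRatio ρ σ z.2 / 2))))
      ((hL.comp measurable_fst).mul (hE.comp measurable_snd))
    simp only [logLik_frestrictLe_succ, add_div, neg_add, Real.exp_add,
      ENNReal.ofReal_mul (Real.exp_nonneg _)]
    rw [h1]
    calc _ ≤ ∫⁻ ω, ENNReal.ofReal (Real.exp (-(logLik ρ σ k (frestrictLe k ω) / 2))) *
            ENNReal.ofReal φ ∂(S.law ρ) := by
          refine lintegral_mono fun ω => ?_
          simp only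
          rw [lintegral_const_mul _ hE, S.lintegral_step ρ k _ hE]
          obtain ⟨m, hm, hle⟩ := hnext k (frestrictLe k ω)
          rw [hm, lintegral_dirac_exp_neg_half_logRatio]
          exact mul_le_mul_right (ENNReal.ofReal_le_ofReal hle) _
      _ ≤ _ := by
          have hLk : Measurable fun ω : Path d r =>
              ENNReal.ofReal (Real.exp (-(logLik ρ σ k (frestrictLe k ω) / 2))) :=
            hL.comp (measurable_frestrictLe k)
          rw [lintegral_mul_const _ hLk, pow_succ _ (k + 1)]
          exact mul_le_mul_left ih _

/-- Chernoff's bound at exponent `1/2`. The law continues past the decision, so the unstopped ratio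
can be used. -/
theorem law_logLik_nonpos_le {ρ σ : QState d} {φ : ℝ} (hφ0 : 0 ≤ φ)
    (hinit : ∃ m, S.init = Measure.dirac m ∧ fidelity ρ σ m ≤ φ)
    (hnext : ∀ k h, ∃ m, S.next k h = Measure.dirac m ∧ fidelity ρ σ m ≤ φ) (k : ℕ) :
    (S.law ρ).real {ω | logLik ρ σ k (frestrictLe k ω) ≤ 0} ≤ φ ^ (k + 1) := by
  have hm : MeasurableSet {ω : Path d r | logLik ρ σ k (frestrictLe k ω) ≤ 0} :=
    measurableSet_le ((measurable_logLik ρ σ k).comp (measurable_frestrictLe k)) measurable_const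
  refine ENNReal.toReal_le_of_le_ofReal (pow_nonneg hφ0 _) ?_
  rw [ENNReal.ofReal_pow hφ0]
  refine le_trans ?_ (S.lintegral_exp_neg_half_logLik_le hinit hnext k)
  rw [← lintegral_indicator_one hm]
  refine lintegral_mono fun ω => ?_
  by_cases hω : logLik ρ σ k (frestrictLe k ω) ≤ 0
  · rw [Set.indicator_of_mem (by exact hω), Pi.one_apply, ← ENNReal.ofReal_one]
    exact ENNReal.ofReal_le_ofReal (Real.one_le_exp (by linarith))
  · rw [Set.indicator_of_notMem (by exact hω)]
    exact zero_le

/-- Before the decision the ratio is at most `a`; the deciding round overshoots by at most `C`, and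
then the sum is frozen. -/
theorem stoppedLogLik_le {ρ σ : QState d} {a C : ℝ} (ha : 0 ≤ a)
    (hC : ∀ y : POVM d r × Fin r, |logRatio ρ σ y| ≤ C)
    (hdec : ∀ k h, S.decision k h = none → logLik ρ σ k h ≤ a) (k : ℕ) (ω : Path d r) :
    S.stoppedLogLik ρ σ k ω ≤ a + C := by
  induction k with
  | zero =>
    have h := (le_abs_self _).trans (hC (ω 0))
    simp only [stoppedLogLik, Finset.range_zero, Finset.sum_empty, add_zero]
    linarith
  | succ k ih =>
    have h1 : S.stoppedLogLik ρ σ (k + 1) ω = S.stoppedLogLik ρ σ k ω +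
        (S.undecided k).indicator (fun ω => logRatio ρ σ (ω (k + 1))) ω := by
      rw [stoppedLogLik, Finset.sum_range_succ, ← add_assoc]
      rfl
    by_cases hω : ω ∈ S.undecided k
    · rw [h1, S.stoppedLogLik_of_mem_undecided ρ σ fun i hi => S.undecided_antitone hi.le hω,
        Set.indicator_of_mem hω]
      exact add_le_add (hdec k _ (S.mem_undecided.mp hω k le_rfl))
        ((le_abs_self _).trans (hC (ω (k + 1))))
    · rw [h1, Set.indicator_of_notMem hω, add_zero]
      exact ih

/-- A bound on the expected number of samples of a test that stops no later than the
log-likelihood ratio exceeds `a`, and whose measurements have an information gain of at least `D`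
whenever the log-likelihood ratio is positive. -/
theorem expectedTime_le {ρ σ : QState d} (hρ : ρ.FullSupport) (hσ : σ.FullSupport)
    {a C D φ : ℝ} (ha : 0 ≤ a) (hC : ∀ y : POVM d r × Fin r, |logRatio ρ σ y| ≤ C) (hD : 0 < D)
    (hφ0 : 0 ≤ φ) (hφ1 : φ < 1)
    (hdec : ∀ k h, S.decision k h = none → logLik ρ σ k h ≤ a)
    (hinit : ∃ m, S.init = Measure.dirac m ∧ fidelity ρ σ m ≤ φ)
    (hnext : ∀ k h, ∃ m, S.next k h = Measure.dirac m ∧ fidelity ρ σ m ≤ φ)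
    (hgain : ∀ k h, 0 < logLik ρ σ k h → D ≤ ∫ m, outcomeRelEntropy ρ σ m ∂(S.next k h)) :
    S.expectedTime ρ ≤ ENNReal.ofReal (1 + ((a + C) / D + 1 / (1 - φ))) := by
  have hN : ∀ j, MeasurableSet {ω : Path d r | logLik ρ σ j (frestrictLe j ω) ≤ 0} := fun j =>
    measurableSet_le ((measurable_logLik ρ σ j).comp (measurable_frestrictLe j)) measurable_const
  have hsum : ∀ k, ∑ j ∈ Finset.range k, (S.law ρ).real (S.undecided j) ≤
      (a + C) / D + 1 / (1 - φ) := by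
    intro k
    -- An undecided round gains at least `D`, except where the ratio is not positive. There the gain
    -- is only nonnegative, and that event has probability at most `φ ^ (j + 1)`.
    have h1 : ∀ j, D * ((S.law ρ).real (S.undecided j) - φ ^ j) ≤
        ∫ ω, (S.undecided j).indicator (fun ω =>
          ∫ m, outcomeRelEntropy ρ σ m ∂(S.next j (frestrictLe j ω))) ω ∂(S.law ρ) := by
      intro j
      have hUi : Integrable ((S.undecided j).indicator fun _ => D) (S.law ρ) :=
        (integrable_const D).indicator (S.measurableSet_undecided j)
      have hNi : Integrable ({ω : Path d r | logLik ρ σ j (frestrictLe j ω) ≤ 0}.indicator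
          fun _ => D) (S.law ρ) := (integrable_const D).indicator (hN j)
      have h2 : ∫ ω, ((S.undecided j).indicator (fun _ => D) ω -
          {ω : Path d r | logLik ρ σ j (frestrictLe j ω) ≤ 0}.indicator (fun _ => D) ω)
            ∂(S.law ρ) ≤ ∫ ω, (S.undecided j).indicator (fun ω =>
          ∫ m, outcomeRelEntropy ρ σ m ∂(S.next j (frestrictLe j ω))) ω ∂(S.law ρ) := by
        refine integral_mono (hUi.sub hNi) ?_ fun ω => ?_
        · obtain ⟨C', hC0, hC'⟩ := exists_abs_logRatio_le hρ hσ
          have hmeas : Measurable fun h : History d r j =>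
              ∫ m, outcomeRelEntropy ρ σ m ∂(S.next j h) := by
            rw [← funext fun h => S.integral_step_logRatio hρ hσ j h]
            exact (StronglyMeasurable.integral_kernel_prod_right' (κ := S.step ρ j)
              ((measurable_logRatio ρ σ).comp measurable_snd).stronglyMeasurable).measurable
          refine Integrable.indicator (Integrable.of_bound
            (hmeas.comp (measurable_frestrictLe j)).aestronglyMeasurable C'
            (ae_of_all _ fun ω => ?_)) (S.measurableSet_undecided j)
          rw [← S.integral_step_logRatio hρ hσ]
          refine (norm_integral_le_of_norm_le_const (ae_of_all _ fun y => hC' y)).trans ?_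
          simp
        · have hnn : 0 ≤ ∫ m, outcomeRelEntropy ρ σ m ∂(S.next j (frestrictLe j ω)) :=
            integral_nonneg fun m => outcomeRelEntropy_nonneg hρ hσ m
          by_cases hU : ω ∈ S.undecided j
          · by_cases hL : logLik ρ σ j (frestrictLe j ω) ≤ 0
            · simp [hU, hL, hnn]
            · simpa [hU, hL] using hgain j _ (not_le.mp hL)
          · simp only [hU, not_false_eq_true, Set.indicator_of_notMem, zero_sub, neg_nonpos]
            exact Set.indicator_nonneg (fun _ _ => hD.le) ω
      refine le_trans ?_ h2
      rw [integral_sub hUi hNi, integral_indicator (S.measurableSet_undecided j),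
        integral_indicator (hN j), setIntegral_const, setIntegral_const, smul_eq_mul, smul_eq_mul,
        ← sub_mul, mul_comm]
      refine mul_le_mul_of_nonneg_right (sub_le_sub_left ?_ _) hD.le
      exact (S.law_logLik_nonpos_le hφ0 hinit hnext j).trans
        (pow_le_pow_of_le_one hφ0 hφ1.le (Nat.le_succ j))
    have h2 : ∫ ω, S.stoppedLogLik ρ σ k ω ∂(S.law ρ) ≤ a + C := by
      obtain ⟨B, hB⟩ := S.exists_abs_stoppedLogLik_le hρ hσ k
      have := integral_mono (μ := S.law ρ)
        (Integrable.of_bound (S.measurable_stoppedLogLik ρ σ k).aestronglyMeasurable B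
          (ae_of_all _ fun ω => hB ω)) (integrable_const (a + C))
        fun ω => S.stoppedLogLik_le ha hC hdec k ω
      simpa using this
    rw [S.integral_stoppedLogLik hρ hσ] at h2
    -- The gain of the initial round is discarded; this costs only a constant.
    have h3 : 0 ≤ ∫ m, outcomeRelEntropy ρ σ m ∂S.init :=
      integral_nonneg fun m => outcomeRelEntropy_nonneg hρ hσ m
    have h4 := Finset.sum_le_sum fun j (_ : j ∈ Finset.range k) => h1 j
    rw [← Finset.mul_sum, Finset.sum_sub_distrib] at h4
    have h5 : ∑ j ∈ Finset.range k, φ ^ j ≤ 1 / (1 - φ) := by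
      rw [one_div, ← tsum_geometric_of_lt_one hφ0 hφ1]
      exact (summable_geometric_of_lt_one hφ0 hφ1).sum_le_tsum _ fun j _ => pow_nonneg hφ0 j
    have h6 : ∑ j ∈ Finset.range k, (S.law ρ).real (S.undecided j) -
        ∑ j ∈ Finset.range k, φ ^ j ≤ (a + C) / D := by
      rw [le_div_iff₀ hD, mul_comm]
      linarith
    linarith
  have hnn : 0 ≤ (a + C) / D + 1 / (1 - φ) := by simpa using hsum 0
  rw [expectedTime_eq_tsum, ENNReal.ofReal_add zero_le_one hnn, ENNReal.ofReal_one]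
  refine add_le_add_right ?_ 1
  rw [ENNReal.tsum_eq_iSup_nat]
  refine iSup_le fun k => ?_
  have h1 : ∑ j ∈ Finset.range k, S.law ρ (S.undecided j) =
      ENNReal.ofReal (∑ j ∈ Finset.range k, (S.law ρ).real (S.undecided j)) := by
    rw [ENNReal.ofReal_sum_of_nonneg fun j _ => measureReal_nonneg]
    exact Finset.sum_congr rfl fun j _ => (ofReal_measureReal (measure_ne_top _ _)).symm
  rw [h1]
  exact ENNReal.ofReal_le_ofReal (hsum k)

end SQHT

/-- The measurement `m₀` if the log-likelihood ratio favours `ρ₀`, and `m₁` otherwise. -/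
noncomputable def adaptiveChoice (ρ₀ ρ₁ : QState d) (m₀ m₁ : POVM d r) (k : ℕ)
    (h : History d r k) : POVM d r :=
  open Classical in if 0 ≤ logLik ρ₀ ρ₁ k h then m₀ else m₁

theorem measurable_adaptiveChoice (ρ₀ ρ₁ : QState d) (m₀ m₁ : POVM d r) (k : ℕ) :
    Measurable (adaptiveChoice ρ₀ ρ₁ m₀ m₁ k) :=
  Measurable.ite (measurableSet_le measurable_const (measurable_logLik ρ₀ ρ₁ k))
    measurable_const measurable_const

/-- The sequential probability ratio test with thresholds `a` and `-b` that uses the measurement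
`m₀` if the log-likelihood ratio favours `ρ₀`, and `m₁` otherwise. -/
noncomputable def sprt (ρ₀ ρ₁ : QState d) (m₀ m₁ : POVM d r) (a b : ℝ) : SQHT d r where
  init := Measure.dirac m₀
  next k := Kernel.deterministic _ (measurable_adaptiveChoice ρ₀ ρ₁ m₀ m₁ k)
  decision k h := open Classical in
    if a ≤ logLik ρ₀ ρ₁ k h then some 0 else if logLik ρ₀ ρ₁ k h ≤ -b then some 1 else none
  isProbabilityMeasure_init := inferInstance
  isMarkovKernel_next _ := inferInstance
  measurableSet_decision k o := by
    classical
    -- The discrete σ-algebra reduces the claim to measurability of the nested conditional.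
    let _ : MeasurableSpace (Option (Fin 2)) := ⊤
    exact Measurable.ite (measurableSet_le measurable_const (measurable_logLik ρ₀ ρ₁ k))
      measurable_const (Measurable.ite (measurableSet_le (measurable_logLik ρ₀ ρ₁ k)
        measurable_const) measurable_const measurable_const) (measurableSet_singleton o)

section Sprt

variable (ρ₀ ρ₁ : QState d) (m₀ m₁ : POVM d r) (a b : ℝ)

theorem sprt_decision_eq_zero {k : ℕ} {h : History d r k}
    (hd : (sprt ρ₀ ρ₁ m₀ m₁ a b).decision k h = some 0) : a ≤ logLik ρ₀ ρ₁ k h := by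
  by_contra hlt
  simp only [sprt, hlt, if_false] at hd
  split_ifs at hd
  simp at hd

theorem sprt_decision_eq_one {k : ℕ} {h : History d r k}
    (hd : (sprt ρ₀ ρ₁ m₀ m₁ a b).decision k h = some 1) : b ≤ logLik ρ₁ ρ₀ k h := by
  rw [logLik_swap ρ₀ ρ₁]
  by_contra hlt
  have h1 : ¬ logLik ρ₀ ρ₁ k h ≤ -b := fun h => hlt (by linarith)
  simp only [sprt, h1, if_false] at hd
  split_ifs at hd
  simp at hd

theorem sprt_decision_eq_none {k : ℕ} {h : History d r k}
    (hd : (sprt ρ₀ ρ₁ m₀ m₁ a b).decision k h = none) :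
    logLik ρ₀ ρ₁ k h ≤ a ∧ logLik ρ₁ ρ₀ k h ≤ b := by
  simp only [sprt] at hd
  split_ifs at hd with h1 h2
  rw [logLik_swap ρ₀ ρ₁]
  constructor <;> linarith

theorem sprt_next (k : ℕ) (h : History d r k) :
    (sprt ρ₀ ρ₁ m₀ m₁ a b).next k h = Measure.dirac (adaptiveChoice ρ₀ ρ₁ m₀ m₁ k h) :=
  Kernel.deterministic_apply (measurable_adaptiveChoice ρ₀ ρ₁ m₀ m₁ k) h

theorem adaptiveChoice_mem (k : ℕ) (h : History d r k) :
    adaptiveChoice ρ₀ ρ₁ m₀ m₁ k h = m₀ ∨ adaptiveChoice ρ₀ ρ₁ m₀ m₁ k h = m₁ := by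
  unfold adaptiveChoice
  split_ifs <;> simp

theorem integral_sprt_next {ρ σ : QState d} (k : ℕ) (h : History d r k) :
    ∫ m, outcomeRelEntropy ρ σ m ∂((sprt ρ₀ ρ₁ m₀ m₁ a b).next k h) =
      outcomeRelEntropy ρ σ (adaptiveChoice ρ₀ ρ₁ m₀ m₁ k h) := by
  rw [sprt_next, integral_dirac']
  exact (Finset.measurable_sum _ fun x _ => (measurable_bornProb ρ x).mul
    ((measurable_logRatio ρ σ).comp measurable_prodMk_right)).stronglyMeasurable

end Sprt

/-- Zero relative entropy means equal outcome laws, a symmetric condition. Hence each of the two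
measurements separates the states in both directions. -/
theorem outcomeRelEntropy_ne_zero_symm {ρ σ : QState d} (hρ : ρ.FullSupport)
    (hσ : σ.FullSupport) {m : POVM d r} (h : outcomeRelEntropy ρ σ m ≠ 0) :
    outcomeRelEntropy σ ρ m ≠ 0 := by
  intro h0
  refine h (Finset.sum_eq_zero fun x _ => ?_)
  have h1 := bornProb_eq_of_outcomeRelEntropy_eq_zero hσ hρ h0 x
  unfold logRatio
  rcases eq_or_ne (bornProb ρ m x) 0 with h2 | h2
  · simp [h2]
  · simp [h1, h2, div_self]

/-- The performance of the sequential probability ratio test. -/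
theorem exists_sprt_bounds {ρ₀ ρ₁ : QState d} (h₀ : ρ₀.FullSupport) (h₁ : ρ₁.FullSupport)
    {m₀ m₁ : POVM d r} (hm₀ : 0 < outcomeRelEntropy ρ₀ ρ₁ m₀)
    (hm₁ : 0 < outcomeRelEntropy ρ₁ ρ₀ m₁) :
    ∃ K : ℝ, ∀ a b : ℝ, 0 ≤ a → 0 ≤ b →
      (sprt ρ₀ ρ₁ m₀ m₁ a b).law ρ₀ ((sprt ρ₀ ρ₁ m₀ m₁ a b).declares 1) ≤
        ENNReal.ofReal (Real.exp (-b)) ∧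
      (sprt ρ₀ ρ₁ m₀ m₁ a b).law ρ₁ ((sprt ρ₀ ρ₁ m₀ m₁ a b).declares 0) ≤
        ENNReal.ofReal (Real.exp (-a)) ∧
      (sprt ρ₀ ρ₁ m₀ m₁ a b).expectedTime ρ₀ ≤
        ENNReal.ofReal (a / outcomeRelEntropy ρ₀ ρ₁ m₀ + K) ∧
      (sprt ρ₀ ρ₁ m₀ m₁ a b).expectedTime ρ₁ ≤
        ENNReal.ofReal (b / outcomeRelEntropy ρ₁ ρ₀ m₁ + K) := by
  obtain ⟨C, hC0, hC⟩ := exists_abs_logRatio_le h₀ h₁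
  obtain ⟨C', hC0', hC'⟩ := exists_abs_logRatio_le h₁ h₀
  set D₀ := outcomeRelEntropy ρ₀ ρ₁ m₀
  set D₁ := outcomeRelEntropy ρ₁ ρ₀ m₁
  -- Under either state the test may use both measurements, so the decay rate must cover both.
  set φ := max (fidelity ρ₀ ρ₁ m₀) (fidelity ρ₀ ρ₁ m₁)
  set φ' := max (fidelity ρ₁ ρ₀ m₀) (fidelity ρ₁ ρ₀ m₁)
  have hφ0 : 0 ≤ φ := le_max_of_le_left (fidelity_nonneg _ _ _)
  have hφ0' : 0 ≤ φ' := le_max_of_le_left (fidelity_nonneg _ _ _)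
  have hφ1 : φ < 1 := max_lt (fidelity_lt_one h₀ h₁ hm₀.ne')
    (fidelity_lt_one h₀ h₁ (outcomeRelEntropy_ne_zero_symm h₁ h₀ hm₁.ne'))
  have hφ1' : φ' < 1 := max_lt
    (fidelity_lt_one h₁ h₀ (outcomeRelEntropy_ne_zero_symm h₀ h₁ hm₀.ne'))
    (fidelity_lt_one h₁ h₀ hm₁.ne')
  refine ⟨max (1 + (C / D₀ + 1 / (1 - φ))) (1 + (C' / D₁ + 1 / (1 - φ'))),
    fun a b ha hb => ⟨?_, ?_, ?_, ?_⟩⟩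
  · exact (sprt ρ₀ ρ₁ m₀ m₁ a b).law_declares_le_exp h₁ h₀
      fun k h hd => sprt_decision_eq_one _ _ _ _ _ _ hd
  · exact (sprt ρ₀ ρ₁ m₀ m₁ a b).law_declares_le_exp h₀ h₁
      fun k h hd => sprt_decision_eq_zero _ _ _ _ _ _ hd
  · refine ((sprt ρ₀ ρ₁ m₀ m₁ a b).expectedTime_le h₀ h₁ ha (fun y => hC y) hm₀ hφ0 hφ1
      (fun k h hd => (sprt_decision_eq_none _ _ _ _ _ _ hd).1) ⟨m₀, rfl, le_max_left _ _⟩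
      (fun k h => ⟨_, sprt_next _ _ _ _ _ _ k h, ?_⟩) fun k h hL => ?_).trans
      (ENNReal.ofReal_le_ofReal ?_)
    · rcases adaptiveChoice_mem ρ₀ ρ₁ m₀ m₁ k h with h2 | h2 <;> rw [h2]
      · exact le_max_left _ _
      · exact le_max_right _ _
    -- The gain is required only where the ratio is strictly positive, so the choice at a tie does
    -- not matter.
    · rw [integral_sprt_next, adaptiveChoice, if_pos hL.le]
    · have := le_max_left (1 + (C / D₀ + 1 / (1 - φ))) (1 + (C' / D₁ + 1 / (1 - φ')))
      rw [add_div]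
      linarith
  · refine ((sprt ρ₀ ρ₁ m₀ m₁ a b).expectedTime_le h₁ h₀ hb (fun y => hC' y) hm₁ hφ0' hφ1'
      (fun k h hd => (sprt_decision_eq_none _ _ _ _ _ _ hd).2) ⟨m₀, rfl, le_max_left _ _⟩
      (fun k h => ⟨_, sprt_next _ _ _ _ _ _ k h, ?_⟩) fun k h hL => ?_).trans
      (ENNReal.ofReal_le_ofReal ?_)
    · rcases adaptiveChoice_mem ρ₀ ρ₁ m₀ m₁ k h with h2 | h2 <;> rw [h2]
      · exact le_max_left _ _
      · exact le_max_right _ _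
    · rw [logLik_swap ρ₀ ρ₁] at hL
      rw [integral_sprt_next, adaptiveChoice, if_neg (by linarith)]
    · have := le_max_right (1 + (C / D₀ + 1 / (1 - φ))) (1 + (C' / D₁ + 1 / (1 - φ')))
      rw [add_div]
      linarith

theorem le_log_of_le_ofReal_exp {β : ℝ≥0∞} {n : ℕ} (hn : 0 < n) {R : ℝ}
    (h : β ≤ ENNReal.ofReal (Real.exp (-(n * R)))) :
    (R : EReal) ≤ ((1 / n : ℝ) : EReal) * ENNReal.log β⁻¹ := by
  have hn' : (0 : ℝ) < n := by exact_mod_cast hn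
  have h1 : ((n * R : ℝ) : EReal) ≤ ENNReal.log β⁻¹ := by
    refine le_trans (le_of_eq ?_) (ENNReal.log_monotone (ENNReal.inv_le_inv.mpr h))
    rw [ENNReal.log_inv, ENNReal.log_pos_real
      (ENNReal.ofReal_pos.mpr (Real.exp_pos _)).ne' ENNReal.ofReal_ne_top,
      ENNReal.toReal_ofReal (Real.exp_pos _).le, Real.log_exp, ← EReal.coe_neg, neg_neg]
  refine le_trans (le_of_eq ?_) (mul_le_mul_of_nonneg_left h1
    (EReal.coe_nonneg.mpr (one_div_nonneg.mpr hn'.le)))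
  rw [← EReal.coe_mul, one_div, inv_mul_cancel_left₀ hn'.ne']

theorem exists_lt_outcomeRelEntropy {ρ σ : QState d} (hσ : σ.FullSupport) {R : ℝ} (hR : 0 ≤ R)
    (h : ENNReal.ofReal R < measuredRelEntropy ρ σ) :
    ∃ m : POVM d d, R < outcomeRelEntropy ρ σ m := by
  rw [measuredRelEntropy_eq_iSup ρ hσ] at h
  simp only [lt_iSup_iff] at h
  obtain ⟨m, -, hm⟩ := h
  exact ⟨m, (ENNReal.ofReal_lt_ofReal_iff_of_nonneg hR).mp hm⟩

theorem tendsto_ofReal_exp_neg_mul {R : ℝ} (hR : 0 < R) :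
    Tendsto (fun n : ℕ => ENNReal.ofReal (Real.exp (-(n * R)))) atTop (𝓝 0) := by
  rw [← ENNReal.ofReal_zero]
  exact ENNReal.tendsto_ofReal (Real.tendsto_exp_neg_atTop_nhds_zero.comp
    (tendsto_natCast_atTop_atTop.atTop_mul_const hR))

theorem isAchievable_of_lt {ρ₀ ρ₁ : QState d} (h₀ : ρ₀.FullSupport) (h₁ : ρ₁.FullSupport)
    {R : ℝ × ℝ} (hR₁ : 0 < R.1) (hR₂ : 0 < R.2)
    (hlt₁ : ENNReal.ofReal R.1 < measuredRelEntropy ρ₁ ρ₀)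
    (hlt₂ : ENNReal.ofReal R.2 < measuredRelEntropy ρ₀ ρ₁) : IsAchievable ρ₀ ρ₁ R := by
  obtain ⟨m₀, hm₀⟩ := exists_lt_outcomeRelEntropy h₁ hR₂.le hlt₂
  obtain ⟨m₁, hm₁⟩ := exists_lt_outcomeRelEntropy h₀ hR₁.le hlt₁
  obtain ⟨K, hK⟩ := exists_sprt_bounds h₀ h₁ (hR₂.trans hm₀) (hR₁.trans hm₁)
  -- The upper threshold controls the error under `ρ₁` and the duration under `ρ₀`, hence the
  -- crossed rates.
  have hS := fun n : ℕ => hK (n * R.2) (n * R.1) (by positivity) (by positivity)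
  -- The strict gap between rate and gain absorbs the constant `K`, so the mean is at most `n`
  -- itself.
  have htime : ∀ {D R : ℝ}, 0 < R → R < D →
      ∀ᶠ n : ℕ in atTop, ENNReal.ofReal (n * R / D + K) ≤ ENNReal.ofReal n := by
    intro D R hR hD
    have hpos : 0 < 1 - R / D := by
      rw [sub_pos, div_lt_one (hR.trans hD)]
      exact hD
    filter_upwards [(tendsto_natCast_atTop_atTop.atTop_mul_const hpos).eventually_ge_atTop K]
      with n hn
    refine ENNReal.ofReal_le_ofReal ?_
    rw [mul_div_assoc]
    linarith
  refine ⟨hR₁.le, hR₂.le, fun _ => d, fun n => sprt ρ₀ ρ₁ m₀ m₁ (n * R.2) (n * R.1),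
    ?_, ?_, ?_, ?_, ?_⟩
  · exact tendsto_of_tendsto_of_tendsto_of_le_of_le tendsto_const_nhds
      (tendsto_ofReal_exp_neg_mul hR₁) (fun _ => zero_le) fun n => (hS n).1
  · exact tendsto_of_tendsto_of_tendsto_of_le_of_le tendsto_const_nhds
      (tendsto_ofReal_exp_neg_mul hR₂) (fun _ => zero_le) fun n => (hS n).2.1
  · refine le_liminf_of_le (by isBoundedDefault) ?_
    filter_upwards [eventually_gt_atTop 0] with n hn
    exact le_log_of_le_ofReal_exp hn (hS n).1
  · refine le_liminf_of_le (by isBoundedDefault) ?_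
    filter_upwards [eventually_gt_atTop 0] with n hn
    exact le_log_of_le_ofReal_exp hn (hS n).2.1
  · refine limsup_le_of_le (by isBoundedDefault) ?_
    filter_upwards [htime hR₂ hm₀, htime hR₁ hm₁] with n hn₀ hn₁
    have h1 := max_le ((hS n).2.2.1.trans hn₀) ((hS n).2.2.2.trans hn₁)
    rw [← EReal.coe_ennreal_le_coe_ennreal_iff, EReal.coe_ennreal_ofReal,
      max_eq_left (Nat.cast_nonneg n)] at h1
    exact EReal.sub_nonpos.mpr h1

/-- Covers rates on the axes: a zero threshold would not make the error vanish, so they are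
inherited from positive pairs. -/
theorem IsAchievable.mono {ρ₀ ρ₁ : QState d} {R R' : ℝ × ℝ} (h : IsAchievable ρ₀ ρ₁ R)
    (h0 : 0 ≤ R'.1) (h0' : 0 ≤ R'.2) (h1 : R'.1 ≤ R.1) (h2 : R'.2 ≤ R.2) :
    IsAchievable ρ₀ ρ₁ R' := by
  obtain ⟨-, -, r, S, hα, hβ, hR₁, hR₂, hT⟩ := h
  exact ⟨h0, h0', r, S, hα, hβ, (EReal.coe_le_coe_iff.mpr h1).trans hR₁,
    (EReal.coe_le_coe_iff.mpr h2).trans hR₂, hT⟩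

/-- Positivity of `D` handles `R = 0`; for `R > 0` the factor `t < 1` makes room below `D`. -/
theorem exists_pos_between {R t : ℝ} {D : ℝ≥0∞} (hD : 0 < D) (hR : 0 ≤ R)
    (hle : ENNReal.ofReal R ≤ D) (ht : t < 1) :
    ∃ x : ℝ, 0 < x ∧ t * R ≤ x ∧ ENNReal.ofReal x < D := by
  have h1 : ENNReal.ofReal (t * R) < D := by
    rcases hR.eq_or_lt with h0 | h0
    · simpa [← h0] using hD
    · exact ((ENNReal.ofReal_lt_ofReal_iff h0).mpr (by nlinarith)).trans_le hle
  obtain ⟨y, hy1, hy2⟩ := exists_between h1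
  have hy : y ≠ ⊤ := hy2.ne_top
  refine ⟨y.toReal, ENNReal.toReal_pos (pos_of_gt hy1).ne' hy, ?_, by rwa [ENNReal.ofReal_toReal hy]⟩
  exact (ENNReal.ofReal_le_iff_le_toReal hy).mp hy1.le

theorem isClosed_exponentRegion (D₁ D₂ : ℝ≥0∞) :
    IsClosed {R : ℝ × ℝ | 0 ≤ R.1 ∧ 0 ≤ R.2 ∧ ENNReal.ofReal R.1 ≤ D₁ ∧
      ENNReal.ofReal R.2 ≤ D₂} := by
  refine (isClosed_le continuous_const continuous_fst).inter
    ((isClosed_le continuous_const continuous_snd).inter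
    ((isClosed_le (ENNReal.continuous_ofReal.comp continuous_fst) continuous_const).inter
    (isClosed_le (ENNReal.continuous_ofReal.comp continuous_snd) continuous_const)))

end Achievability

end SeqQHT

theorem theorem2 {d : ℕ} (ρ₀ ρ₁ : SeqQHT.QState d)
    (h₀ : ρ₀.FullSupport) (h₁ : ρ₁.FullSupport) (hne : ρ₀ ≠ ρ₁) :
    SeqQHT.errorExponentRegion ρ₀ ρ₁ =
      {R : ℝ × ℝ | 0 ≤ R.1 ∧ 0 ≤ R.2 ∧
        ENNReal.ofReal R.1 ≤ SeqQHT.measuredRelEntropy ρ₁ ρ₀ ∧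
        ENNReal.ofReal R.2 ≤ SeqQHT.measuredRelEntropy ρ₀ ρ₁} := by
  refine Set.Subset.antisymm ?_ ?_
  · refine closure_minimal (fun R hR => ?_) (SeqQHT.isClosed_exponentRegion _ _)
    exact ⟨hR.1, hR.2.1, hR.le_measuredRelEntropy h₀ h₁⟩
  · rintro R ⟨hR₁, hR₂, hle₁, hle₂⟩
    -- The shrunken pairs are dominated by positive pairs strictly below both entropies, hence
    -- achievable, and they converge to `R`.
    have hlim : Tendsto (fun n : ℕ => ((1 - 1 / ((n : ℝ) + 1)) * R.1,
        (1 - 1 / ((n : ℝ) + 1)) * R.2)) atTop (𝓝 R) := by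
      have h : Tendsto (fun n : ℕ => 1 - 1 / ((n : ℝ) + 1)) atTop (𝓝 1) := by
        simpa using tendsto_one_div_add_atTop_nhds_zero_nat (𝕜 := ℝ) |>.const_sub 1
      simpa using (h.mul_const R.1).prodMk_nhds (h.mul_const R.2)
    refine mem_closure_of_tendsto hlim (Eventually.of_forall fun n => ?_)
    have hpos : (0 : ℝ) < (n : ℝ) + 1 := by positivity
    have ht1 : 1 - 1 / ((n : ℝ) + 1) < 1 := by
      have := one_div_pos.mpr hpos
      linarith
    have ht0 : 0 ≤ 1 - 1 / ((n : ℝ) + 1) := by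
      rw [sub_nonneg, div_le_one hpos]
      have := Nat.cast_nonneg (α := ℝ) n
      linarith
    obtain ⟨x, hx0, hx1, hx2⟩ :=
      SeqQHT.exists_pos_between (SeqQHT.measuredRelEntropy_pos h₁ h₀ hne.symm) hR₁ hle₁ ht1
    obtain ⟨y, hy0, hy1, hy2⟩ :=
      SeqQHT.exists_pos_between (SeqQHT.measuredRelEntropy_pos h₀ h₁ hne) hR₂ hle₂ ht1
    exact (SeqQHT.isAchievable_of_lt (R := (x, y)) h₀ h₁ hx0 hy0 hx2 hy2).mono
      (mul_nonneg ht0 hR₁) (mul_nonneg ht0 hR₂) hx1 hy1
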